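/- **Setting.** Let $G=(V,E)$ be a connected undirected graph on $n\ge 2$ vertices with Laplacian $L=D-A$. For a symmetric matrix $M$ let $\mathcal R_M=\max_i (M^+)_{ii}$, where $M^+$ is the pseudo-inverse. The PD-Laplacian is $\bar L=L+\mathcal R_L^{-1}\frac1{n^2}J$, with $J$ the all-ones matrix. Let $y:V\to[k]$ assign the vertices to $k$ classes, with indicator matrix $R\in\{0,1\}^{n\times k}$ ($R_{is}=1$ iff $y_i=s$). Let $|\Phi|$ be the number of edges joining different classes, $r_{ij}=(e_i-e_j)^{T}L^+(e_i-e_j)$ the effective resistance, and $r_G=\max_{i,j}r_{ij}$. Let $U=RU^*R^{T}$ for some $U^*\in\{-1,1\}^{k\times k}$; the case $U^*_{ss}=1$, $U^*_{rs}=-1$ ($r\ne s$) is the similarity matrix, with $U_{ij}=1$ if $y_i=y_j$ and $U_{ij}=-1$ otherwise. For a margin $\gamma>0$, the quasi-dimension $\mathcal D^\gamma(U)$ is the infimum of $\mathcal R_{\bar L}\mathrm{Tr}(P^{T}\bar LP)+\mathcal R_{\bar L}\mathrm{Tr}(Q^{T}\bar LQ)$ over all $d$ and all $P,Q\in\mathbb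 R^{n\times d}$ with rows of Euclidean norm $1$ and $PQ^{T}=\gamma U$; $\gamma$ is *feasible* for $U$ if such $P,Q$ exist. Let $\mathcal X_{\widehat{\mathcal D}}$ be the set of all $PQ^{T}$ with $P,Q$ having unit rows and $\mathcal R_{\bar L}\mathrm{Tr}(P^{T}\bar LP)+\mathcal R_{\bar L}\mathrm{Tr}(Q^{T}\bar LQ)\le\widehat{\mathcal D}$. Let $h_\gamma(x)=0$ if $x\ge\gamma$ and $h_\gamma(x)=1-x/\gamma$ otherwise. **Algorithm** (parameters $\gamma,\eta,\widehat{\mathcal D}$). Let $\Gamma$ be the $2n\times 2n$ block diagonal matrix with both blocks $\sqrt{\mathcal R_{\bar L}\bar L}$, and let $\mathcal K$ be the set of positive semidefinite $W\in\mathbb R^{2n\times2n}$ with $W_{vv}\le1$ for all $v$ and $\mathrm{Tr}(\Gamma W\Gamma)\le\widehat{\mathcal D}$. Start with any $W_1\in\mathcal K$. In round $t$ receive $(i_t,j_t)\in V^2$, let $Z_t=\frac12(e_{i_t}e_{n+j_t}^{T}+e_{n+j_t}e_{i_t}^{T})$, predict $\hat y_t=\mathrm{sgn}(W_t\bullet Z_t)\in\{-1,1\}$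 (either sign if the product is $0$), and receive a label $y_t\in\{-1,1\}$. If $\hat y_t\ne y_t$, put $L_t=-\frac{y_t}{\gamma}Z_t$ and $W_{t+1}=\arg\min_{W\in\mathcal K}\big(-\ln\det(\Gamma W\Gamma+I)+\eta\sum_{s\le t}W\bullet L_s\big)$; otherwise put $L_t=0$ and $W_{t+1}=W_t$. Let $M$ be the number of mistakes in $T$ rounds and $\mathrm{hloss}=\min_{X\in\mathcal X_{\widehat{\mathcal D}}}\sum_{t=1}^Th_\gamma(y_tX_{i_t,j_t})$. **Claim.** For every $\delta>0$ there is $c_0>0$ such that for every $c\in(0,c_0]$ there is $C>0$ (depending only on $\delta$ and $c$) such that the following holds for all $n\ge2$, $G$, $k$, $y$. 1. $\mathrm{Tr}(R^{T}LR)=2|\Phi|$ and $\mathcal R_L\le r_G\le4\mathcal R_L$. Every $\gamma\in(0,1/3]$ is feasible for the similarity matrix. Now let $U$ be as above, let $\gamma>0$ be feasible for $U$, and run the algorithm with $\eta=c\gamma^2$. Write "$M\lesssim B$" for: for all $T$, all pairs, all labels in $\{-1,1\}$ and every run, $M\le B+(1+\delta)\,\mathrm{hloss}$, and moreover $M\le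 B+\mathrm{hloss}$ if $y_t=U_{i_t,j_t}$ for all $t\le T$ (in the similarity case: if the label says whether $i_t$ and $j_t$ are in the same class). 2. For every $\widehat{\mathcal D}\ge\mathcal D^\gamma(U)$: the minimisers used by the algorithm exist and are unique, $\gamma U\in\mathcal X_{\widehat{\mathcal D}}$, the minimum defining $\mathrm{hloss}$ is attained, and $M\lesssim C\widehat{\mathcal D}/\gamma^2$. 3. Let $\widehat{\mathcal D}=8\,\mathrm{Tr}(R^{T}LR)\mathcal R_L+4$. Then $\mathcal D^\gamma(U)\le\widehat{\mathcal D}$, and with this $\widehat{\mathcal D}$: - if at least two classes are non-empty, then $$M\lesssim C\,\frac{\mathrm{Tr}(R^{T}LR)\,\mathcal R_L}{\gamma^2}\qquad\text{and}\qquad M\lesssim C\,\frac{|\Phi|\,r_G}{\gamma^2};$$ - if $\mathrm{Tr}(R^{T}LR)\mathcal R_L\le a k$ for a real $a$, then $M\lesssim C(a+1)k/\gamma^2$; - in particular $O(k/\gamma^2)$ holds for graphs with $O(k)$ cut edges and bounded diameter: if $|\Phi|\le ak$ and any two vertices are joined by a path of length at most $d$, then $M\lesssim C(ad+1)k/\gamma^2$.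 -/

import Mathlib

open Matrix

namespace OnlineSimilarity

noncomputable section

/-! ### Pseudo-inverse, square root, squared radius -/

/-- Moore-Penrose pseudo-inverse of a real symmetric matrix: in an orthonormal eigenbasis, invert
the nonzero eigenvalues and keep the zero ones (`0⁻¹ = 0` in `ℝ`). -/
def pinv {ι : Type*} [Fintype ι] [DecidableEq ι] (A : Matrix ι ι ℝ) : Matrix ι ι ℝ :=
  cfc (fun x : ℝ => x⁻¹) A

/-- Positive semidefinite square root of a real positive semidefinite matrix. -/
def msqrt {ι : Type*} [Fintype ι] [DecidableEq ι] (A : Matrix ι ι ℝ) : Matrix ι ι ℝ :=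
  cfc Real.sqrt A

theorem continuousOn_spectrum {ι : Type*} [Fintype ι] [DecidableEq ι] (A : Matrix ι ι ℝ)
    (f : ℝ → ℝ) : ContinuousOn f (spectrum ℝ A) :=
  (Matrix.finite_real_spectrum (A := A)).continuousOn f

/-- The four Penrose equations, which characterise the pseudo-inverse. -/
theorem pinv_penrose {ι : Type*} [Fintype ι] [DecidableEq ι] (A : Matrix ι ι ℝ)
    (hA : A.IsHermitian) :
    A * pinv A * A = A ∧ pinv A * A * pinv A = pinv A ∧
      (A * pinv A)ᵀ = A * pinv A ∧ (pinv A * A)ᵀ = pinv A * A := by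
  have hs : IsSelfAdjoint A := hA
  have c1 := continuousOn_spectrum A (fun x : ℝ => x⁻¹)
  have e0 : cfc (fun x : ℝ => x) A = A := cfc_id' ℝ A
  have e1 : A * pinv A = cfc (fun x : ℝ => x * x⁻¹) A := by
    rw [cfc_mul (fun x : ℝ => x) (fun x : ℝ => x⁻¹) A (continuousOn_spectrum A _) c1, e0]
    rfl
  have e2 : pinv A * A = cfc (fun x : ℝ => x⁻¹ * x) A := by
    rw [cfc_mul (fun x : ℝ => x⁻¹) (fun x : ℝ => x) A c1 (continuousOn_spectrum A _), e0]
    rfl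
  refine ⟨?_, ?_, ?_, ?_⟩
  · rw [e1]
    conv_lhs => rw [← e0]
    rw [cfc_id' ℝ A]
    nth_rewrite 2 [← e0]
    rw [← cfc_mul (fun x : ℝ => x * x⁻¹) (fun x : ℝ => x) A (continuousOn_spectrum A _)
      (continuousOn_spectrum A _)]
    conv_rhs => rw [← e0]
    congr 1
    funext x
    exact mul_inv_mul_cancel x
  · rw [e2]
    unfold pinv
    rw [← cfc_mul (fun x : ℝ => x⁻¹ * x) (fun x : ℝ => x⁻¹) A (continuousOn_spectrum A _) c1]
    congr 1
    funext x
    by_cases hx : x = 0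
    · simp [hx]
    · field_simp
  · rw [e1]
    have h : IsSelfAdjoint (cfc (fun x : ℝ => x * x⁻¹) A) := cfc_predicate _ A
    simpa [star_eq_conjTranspose] using h.star_eq
  · rw [e2]
    have h : IsSelfAdjoint (cfc (fun x : ℝ => x⁻¹ * x) A) := cfc_predicate _ A
    simpa [star_eq_conjTranspose] using h.star_eq

/-- `msqrt A` is a symmetric matrix whose square is `A`. -/
theorem msqrt_mul_self {ι : Type*} [Fintype ι] [DecidableEq ι] (A : Matrix ι ι ℝ)
    (hA : A.PosSemidef) : (msqrt A).IsHermitian ∧ msqrt A * msqrt A = A := by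
  have hs : IsSelfAdjoint A := hA.1
  refine ⟨(cfc_predicate Real.sqrt A : IsSelfAdjoint _), ?_⟩
  unfold msqrt
  rw [← cfc_mul Real.sqrt Real.sqrt A (continuousOn_spectrum A _) (continuousOn_spectrum A _)]
  conv_rhs => rw [← cfc_id' ℝ A]
  refine cfc_congr ?_
  intro x hx
  rw [hA.1.spectrum_real_eq_range_eigenvalues] at hx
  obtain ⟨i, rfl⟩ := hx
  exact Real.mul_self_sqrt (hA.eigenvalues_nonneg i)

/-- Squared radius `R_M = max_i (M⁺)_{ii}`. -/
def sqRadius {ι : Type*} [Fintype ι] [DecidableEq ι] (M : Matrix ι ι ℝ) : ℝ :=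
  ⨆ i, pinv M i i

/-! ### Graph notions -/

section Graph

variable {V : Type*} [Fintype V] [DecidableEq V] (G : SimpleGraph V) [DecidableRel G.Adj]

/-- PD-Laplacian `L + R_L⁻¹ (1/n²) J`, where `L` is the graph Laplacian, `n` the number of
vertices and `J` the all-ones matrix. -/
def pdLaplacian : Matrix V V ℝ :=
  G.lapMatrix ℝ +
    ((sqRadius (G.lapMatrix ℝ))⁻¹ * (1 / (Fintype.card V : ℝ) ^ 2)) • Matrix.of fun _ _ => (1 : ℝ)

/-- Effective resistance `(e_i - e_j)ᵀ L⁺ (e_i - e_j)` (unit resistors on the edges). -/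
def effRes (i j : V) : ℝ :=
  (Pi.single i 1 - Pi.single j 1) ⬝ᵥ
    (pinv (G.lapMatrix ℝ) *ᵥ (Pi.single i 1 - Pi.single j 1))

/-- Resistance diameter: the largest effective resistance between two vertices. -/
def resDiam : ℝ := ⨆ p : V × V, effRes G p.1 p.2

end Graph

/-- Cut-size: the number of (undirected) edges whose end points are in different classes. -/
def cutSize {V : Type*} (G : SimpleGraph V) {k : ℕ} (y : V → Fin k) : ℕ :=
  {e ∈ G.edgeSet | ¬ (e.map y).IsDiag}.ncard

/-- Class indicator matrix `R ∈ {0,1}^{V × k}`: `R_{i,s} = 1` iff vertex `i` is in class `s`. -/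
def classMatrix {V : Type*} {k : ℕ} (y : V → Fin k) : Matrix V (Fin k) ℝ :=
  Matrix.of fun i s => if y i = s then 1 else 0

/-- `1` if two vertices are in the same class, `-1` otherwise. -/
def simMatrix {V : Type*} {k : ℕ} (y : V → Fin k) : Matrix V V ℝ :=
  Matrix.of fun i j => if y i = y j then 1 else -1

/-- The similarity matrix is `R U* Rᵀ` with `U*` equal to `1` on the diagonal and `-1` off it. -/
theorem simMatrix_eq {V : Type*} {k : ℕ} (y : V → Fin k) :
    simMatrix y = classMatrix y * simMatrix (id : Fin k → Fin k) * (classMatrix y)ᵀ := by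
  ext i j
  simp only [simMatrix, classMatrix, Matrix.mul_apply, Matrix.of_apply, Matrix.transpose_apply, id]
  rw [Finset.sum_eq_single (y j) (by intro b _ hb; simp [hb.symm]) (by simp)]
  rw [Finset.sum_eq_single (y i) (by intro b _ hb; simp [hb.symm]) (by simp)]
  simp

/-- `Tr(Rᵀ L R) · R_L`. -/
def cutComplexity {V : Type*} [Fintype V] [DecidableEq V] (G : SimpleGraph V)
    [DecidableRel G.Adj] {k : ℕ} (y : V → Fin k) : ℝ :=
  ((classMatrix y)ᵀ * G.lapMatrix ℝ * classMatrix y).trace * sqRadius (G.lapMatrix ℝ)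

/-! ### Comparators -/

/-- All rows have Euclidean norm `1`. -/
def RowNormalized {ι : Type*} {d : ℕ} (P : Matrix ι (Fin d) ℝ) : Prop :=
  ∀ i, ∑ a, P i a ^ 2 = 1

section Comparators

variable {V : Type*} [Fintype V] [DecidableEq V]

/-- `R_M Tr(Pᵀ M P) + R_N Tr(Qᵀ N Q)`. -/
def sideCost (M N : Matrix V V ℝ) {d : ℕ} (P Q : Matrix V (Fin d) ℝ) : ℝ :=
  sqRadius M * (Pᵀ * M * P).trace + sqRadius N * (Qᵀ * N * Q).trace

/-- The values minimised in the definition of the quasi-dimension of `U` at margin `γ`; the set is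
nonempty iff `γ U` has a row-normalised factorisation, i.e. iff the max norm of `U` is at most
`1 / γ`. -/
def quasiDimValues (γ : ℝ) (M N U : Matrix V V ℝ) : Set ℝ :=
  {r | ∃ (d : ℕ) (P Q : Matrix V (Fin d) ℝ), RowNormalized P ∧ RowNormalized Q ∧
    P * Qᵀ = γ • U ∧ r = sideCost M N P Q}

/-- Quasi-dimension of `U` with side information `M`, `N` at margin `γ`. -/
def quasiDim (γ : ℝ) (M N U : Matrix V V ℝ) : ℝ := sInf (quasiDimValues γ M N U)

/-- The comparator class: products `P Qᵀ` of row-normalised matrices with `sideCost` at most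
`Dhat`. -/
def comparators (M N : Matrix V V ℝ) (Dhat : ℝ) : Set (Matrix V V ℝ) :=
  {X | ∃ (d : ℕ) (P Q : Matrix V (Fin d) ℝ), RowNormalized P ∧ RowNormalized Q ∧
    sideCost M N P Q ≤ Dhat ∧ X = P * Qᵀ}

/-- Hinge loss at margin `γ`. -/
def hinge (γ x : ℝ) : ℝ := if γ ≤ x then 0 else 1 - x / γ

/-- Cumulative hinge loss of `X` on the first `T` rounds. -/
def hingeLoss (γ : ℝ) (T : ℕ) (i j : ℕ → V) (lab : ℕ → ℝ) (X : Matrix V V ℝ) : ℝ :=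
  ∑ t ∈ Finset.range T, hinge γ (lab t * X (i t) (j t))

/-- Smallest cumulative hinge loss over the comparator class. -/
def minHingeLoss (γ : ℝ) (M N : Matrix V V ℝ) (Dhat : ℝ) (T : ℕ) (i j : ℕ → V)
    (lab : ℕ → ℝ) : ℝ :=
  sInf (hingeLoss γ T i j lab '' comparators M N Dhat)

/-! ### The algorithm -/

/-- `Γ`, the block diagonal matrix with blocks `√(R_M M)` and `√(R_N N)`. -/
def sideGamma (M N : Matrix V V ℝ) : Matrix (V ⊕ V) (V ⊕ V) ℝ :=
  Matrix.fromBlocks (msqrt (sqRadius M • M)) 0 0 (msqrt (sqRadius N • N))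

/-- Frobenius inner product. -/
def frob {ι : Type*} [Fintype ι] (A B : Matrix ι ι ℝ) : ℝ := (Aᵀ * B).trace

/-- Decision set: positive semidefinite, diagonal at most `1`, `Γ`-trace norm at most `Dhat`. -/
def decisionSet (Γ : Matrix (V ⊕ V) (V ⊕ V) ℝ) (Dhat : ℝ) : Set (Matrix (V ⊕ V) (V ⊕ V) ℝ) :=
  {W | W.PosSemidef ∧ (∀ v, W v v ≤ 1) ∧ (Γ * W * Γ).trace ≤ Dhat}

/-- The sparse matrix `Z⟨i,j⟩ = (e_i e_{n+j}ᵀ + e_{n+j} e_iᵀ) / 2`. -/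
def sparseZ (i j : V) : Matrix (V ⊕ V) (V ⊕ V) ℝ :=
  (1 / 2 : ℝ) • (Matrix.single (Sum.inl i) (Sum.inr j) 1 + Matrix.single (Sum.inr j) (Sum.inl i) 1)

/-- FTRL objective with the `Γ`-dependent log-determinant regulariser
(`A` is the sum of the past loss matrices). -/
def ftrlObjective (Γ : Matrix (V ⊕ V) (V ⊕ V) ℝ) (η : ℝ) (A W : Matrix (V ⊕ V) (V ⊕ V) ℝ) : ℝ :=
  -Real.log (Γ * W * Γ + 1).det + η * frob W A

/-- `W` minimises the FTRL objective over the decision set. -/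
def IsFTRL (Γ : Matrix (V ⊕ V) (V ⊕ V) ℝ) (Dhat η : ℝ) (A W : Matrix (V ⊕ V) (V ⊕ V) ℝ) : Prop :=
  W ∈ decisionSet Γ Dhat ∧
    ∀ W' ∈ decisionSet Γ Dhat, ftrlObjective Γ η A W ≤ ftrlObjective Γ η A W'

/-- Loss matrix of round `t`: `-(y_t/γ) Z⟨i_t,j_t⟩` on a mistake, `0` otherwise. -/
def lossMatrix (γ : ℝ) (i j : ℕ → V) (lab yhat : ℕ → ℝ) (t : ℕ) : Matrix (V ⊕ V) (V ⊕ V) ℝ :=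
  open Classical in
  if yhat t ≠ lab t then (-(lab t) / γ) • sparseZ (i t) (j t) else 0

/-- `W`, `yhat` are matrices and predictions produced by the mistake-driven FTRL algorithm on the
pairs `(i t, j t)` with revealed labels `lab t`, for `T` rounds (numbered from `0`). The initial
matrix is any element of the decision set; `yhat t` is the sign of `W_t • Z_t`, and either sign is
allowed when that number is `0`. -/
structure IsRun (Γ : Matrix (V ⊕ V) (V ⊕ V) ℝ) (γ Dhat η : ℝ) (T : ℕ) (i j : ℕ → V)
    (lab : ℕ → ℝ) (W : ℕ → Matrix (V ⊕ V) (V ⊕ V) ℝ) (yhat : ℕ → ℝ) : Prop where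
  init : W 0 ∈ decisionSet Γ Dhat
  pred_sign : ∀ t < T, yhat t = 1 ∨ yhat t = -1
  pred_pos : ∀ t < T, 0 < frob (W t) (sparseZ (i t) (j t)) → yhat t = 1
  pred_neg : ∀ t < T, frob (W t) (sparseZ (i t) (j t)) < 0 → yhat t = -1
  keep : ∀ t < T, yhat t = lab t → W (t + 1) = W t
  update : ∀ t < T, yhat t ≠ lab t →
    IsFTRL Γ Dhat η (∑ s ∈ Finset.range (t + 1), lossMatrix γ i j lab yhat s) (W (t + 1))

/-- Number of mistakes in `T` rounds. -/
def mistakes (T : ℕ) (lab yhat : ℕ → ℝ) : ℕ :=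
  open Classical in ((Finset.range T).filter fun t => yhat t ≠ lab t).card

/-- Mistake bound with leading term `B` for the algorithm with side information `M` in both
blocks, quasi-dimension estimate `Dhat` and step size `η`, for every number of rounds, sequence of
pairs and `±1` labels, and every run. The hinge loss has factor `1 + δ` for arbitrary labels and
factor `1` if the labels are those of `U`. -/
def MistakeBound (M U : Matrix V V ℝ) (γ Dhat η δ B : ℝ) : Prop :=
  ∀ (T : ℕ) (i j : ℕ → V) (lab : ℕ → ℝ) (W : ℕ → Matrix (V ⊕ V) (V ⊕ V) ℝ) (yhat : ℕ → ℝ),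
    (∀ t < T, lab t = 1 ∨ lab t = -1) →
    IsRun (sideGamma M M) γ Dhat η T i j lab W yhat →
      (mistakes T lab yhat : ℝ) ≤ B + (1 + δ) * minHingeLoss γ M M Dhat T i j lab ∧
      ((∀ t < T, lab t = U (i t) (j t)) →
        (mistakes T lab yhat : ℝ) ≤ B + minHingeLoss γ M M Dhat T i j lab)

end Comparators

end

end OnlineSimilarity

open OnlineSimilarity

/-! The mistake count `m` is controlled by the minimum value of the FTRL objective, squeezed from
both sides. From above, any `Z` in the decision set shows that the minimum is at most `η (hloss(Z) -
m)`, since the regulariser is nonpositive and each mistake costs `Z` at most its hinge loss minus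
`1`. From below (`IsRun.potential`), the minimum is at least `-Dhat - c γ - 4 c η m` once a mistake
has been made. With `η = c γ ^ 2` this gives `(1 - 4 c) m ≤ hloss(Z) + Dhat / η + 1 / γ`.

The lower bound rests on stability. The function `-log det` is strongly convex along every bilinear
form whose two vectors have bounded energy (`sq_dotProduct_sub_le_log_det`). For the vectors `Γ⁻¹
e_v` this energy is at most `2`, because scaling by the squared radius makes the diagonal of `Γ⁻²`
at most `1`. So the objective is strongly convex in each matrix entry with a constant independent of
`n` (`ftrlObjective_midpoint`), and a loss touching one symmetric pair of entries can lower the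
minimum only by `O(η c)`.

Comparators are exactly the off-diagonal blocks of the unit-diagonal members of the decision set
(`comparators_eq_image`). That set is compact, so the quasi-dimension and the least hinge loss are
attained. In particular `γ U` is a comparator, and its hinge loss vanishes on labels taken from `U`.

For the explicit estimate, a factorisation may be taken constant on classes, so only cut edges carry
energy. The inverse of the PD-Laplacian is `L⁺ + R_L J`, whence its squared radius is `2 R_L`. The
additive constant `4` is absorbed because two nonempty classes force `4 Tr(Rᵀ L R) R_L ≥ 1`, by the
energy characterisation of effective resistance. -/

namespace OnlineSimilarity

/-! ### Spectral bounds and strong convexity of `-log det`. -/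

section LinearAlgebra

variable {ι : Type*} [Fintype ι]

theorem sq_dotProduct_mulVec_le (N : Matrix ι ι ℝ) (u v : ι → ℝ) :
    (u ⬝ᵥ N *ᵥ v) ^ 2 ≤ (u ⬝ᵥ u) * (v ⬝ᵥ v) * (Nᵀ * N).trace := by
  have h := Finset.sum_mul_sq_le_sq_mul_sq (Finset.univ : Finset (ι × ι))
    (fun p => u p.1 * v p.2) (fun p => N p.1 p.2)
  have e1 : ∑ p : ι × ι, u p.1 * v p.2 * N p.1 p.2 = u ⬝ᵥ N *ᵥ v := by
    simp only [Fintype.sum_prod_type, dotProduct, mulVec, Finset.mul_sum]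
    exact Finset.sum_congr rfl fun a _ => Finset.sum_congr rfl fun b _ => by ring
  have e2 : ∑ p : ι × ι, (u p.1 * v p.2) ^ 2 = (u ⬝ᵥ u) * (v ⬝ᵥ v) := by
    simp only [Fintype.sum_prod_type, dotProduct, Finset.sum_mul_sum]
    exact Finset.sum_congr rfl fun a _ => Finset.sum_congr rfl fun b _ => by ring
  have e3 : ∑ p : ι × ι, (N p.1 p.2) ^ 2 = (Nᵀ * N).trace := by
    simp only [Fintype.sum_prod_type, Matrix.trace, diag, mul_apply, transpose_apply]
    rw [Finset.sum_comm]
    exact Finset.sum_congr rfl fun a _ => Finset.sum_congr rfl fun b _ => by ring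
  rwa [e1, e2, e3] at h

variable [DecidableEq ι]

theorem exists_orthogonal_diagonalization {N : Matrix ι ι ℝ} (hN : N.IsHermitian) :
    ∃ (U : Matrix ι ι ℝ) (d : ι → ℝ), Uᵀ * U = 1 ∧ U * Uᵀ = 1 ∧ N = U * diagonal d * Uᵀ := by
  refine ⟨hN.eigenvectorUnitary, hN.eigenvalues, ?_, ?_, ?_⟩
  · have := Unitary.coe_star_mul_self hN.eigenvectorUnitary
    simpa [star_eq_conjTranspose] using this
  · have := Unitary.coe_mul_star_self hN.eigenvectorUnitary
    simpa [star_eq_conjTranspose] using this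
  · have := hN.spectral_theorem
    rw [Unitary.conjStarAlgAut_apply] at this
    simpa [star_eq_conjTranspose] using this

theorem one_add_smul_conj_diagonal {U : Matrix ι ι ℝ} (h : U * Uᵀ = 1) (d : ι → ℝ) (s : ℝ) :
    1 + s • (U * diagonal d * Uᵀ) = U * diagonal (fun i => 1 + s * d i) * Uᵀ := by
  have : diagonal (fun i => 1 + s * d i) = 1 + s • diagonal d := by
    ext a b
    by_cases hab : a = b <;> simp [diagonal, one_apply, hab]
  rw [this, Matrix.mul_add, Matrix.add_mul, Matrix.mul_one, h]
  simp

theorem det_one_add_smul_conj_diagonal {U : Matrix ι ι ℝ} (h : U * Uᵀ = 1) (d : ι → ℝ) (s : ℝ) :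
    (1 + s • (U * diagonal d * Uᵀ)).det = ∏ i, (1 + s * d i) := by
  have h1 : U.det * U.det = 1 := by
    have := congrArg Matrix.det h
    simpa [det_mul] using this
  rw [one_add_smul_conj_diagonal h, det_mul, det_mul, det_diagonal, det_transpose]
  linear_combination (∏ i, (1 + s * d i)) * h1

theorem posDef_one_add_smul_conj_diagonal {U : Matrix ι ι ℝ} (h : U * Uᵀ = 1) (h' : Uᵀ * U = 1)
    {d : ι → ℝ} {s : ℝ} (hp : (1 + s • (U * diagonal d * Uᵀ)).PosDef) (i : ι) :
    0 < 1 + s * d i := by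
  rw [one_add_smul_conj_diagonal h] at hp
  have hu : Function.Injective (U.mulVec) := by
    intro a b hab
    have := congrArg (fun x => Uᵀ *ᵥ x) hab
    simpa [mulVec_mulVec, h'] using this
  have := hp.conjTranspose_mul_mul_same hu
  have e : Uᴴ * (U * diagonal (fun i => 1 + s * d i) * Uᵀ) * U
      = diagonal (fun i => 1 + s * d i) := by
    rw [conjTranspose_eq_transpose_of_trivial]
    calc _ = (Uᵀ * U) * diagonal (fun i => 1 + s * d i) * (Uᵀ * U) := by
          simp only [Matrix.mul_assoc]
      _ = _ := by simp [h']
  rw [e] at this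
  exact (posDef_diagonal_iff.mp this) i

/-- On each eigenvalue `d ≥ 0` this is `0 ≤ log (1 + d) ≤ d`. -/
theorem log_det_one_add_bounds {S : Matrix ι ι ℝ} (hS : S.PosSemidef) :
    0 ≤ Real.log (S + 1).det ∧ Real.log (S + 1).det ≤ S.trace := by
  obtain ⟨U, d, h1, h2, h3⟩ := exists_orthogonal_diagonalization hS.1
  have hd : ∀ i, 0 ≤ d i := by
    have := hS.conjTranspose_mul_mul_same U
    rw [conjTranspose_eq_transpose_of_trivial, h3,
      show Uᵀ * (U * diagonal d * Uᵀ) * U = (Uᵀ * U) * diagonal d * (Uᵀ * U) by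
        simp only [Matrix.mul_assoc], h1] at this
    simpa using this
  have hdet : (S + 1).det = ∏ i, (1 + d i) := by
    have := det_one_add_smul_conj_diagonal h2 d 1
    simpa [← h3, add_comm] using this
  have htr : S.trace = ∑ i, d i := by
    rw [h3, trace_mul_comm, ← Matrix.mul_assoc, h1, Matrix.one_mul, trace_diagonal]
  rw [hdet, htr, Real.log_prod (fun i _ => by linarith [hd i])]
  refine ⟨Finset.sum_nonneg fun i _ => Real.log_nonneg (by linarith [hd i]),
    Finset.sum_le_sum fun i _ => ?_⟩
  linarith [Real.log_le_sub_one_of_pos (show 0 < 1 + d i by linarith [hd i])]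

/-- Divergence between two positive definite matrices, seen through one bilinear form. -/
theorem sq_dotProduct_sub_le_log_det {X Y : Matrix ι ι ℝ} (hX : X.PosDef) (hY : Y.PosDef)
    {u v : ι → ℝ} (hu : u ⬝ᵥ X *ᵥ u ≤ 2) (hu' : u ⬝ᵥ Y *ᵥ u ≤ 2)
    (hv : v ⬝ᵥ X *ᵥ v ≤ 2) (hv' : v ⬝ᵥ Y *ᵥ v ≤ 2) :
    (u ⬝ᵥ (X - Y) *ᵥ v) ^ 2 / 16 ≤
      2 * Real.log ((1 / 2 : ℝ) • (X + Y)).det - Real.log X.det - Real.log Y.det := by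
  set M := (1 / 2 : ℝ) • (X + Y) with hM
  have hMp : M.PosDef := (hX.add hY).smul (by norm_num)
  obtain ⟨hSh, hSS⟩ := msqrt_mul_self M hMp.posSemidef
  set S := msqrt M
  have hSt : Sᵀ = S := by simpa [IsHermitian] using hSh
  have hdS : S.det * S.det = M.det := by rw [← det_mul, hSS]
  have hSu : IsUnit S.det := by
    rw [isUnit_iff_ne_zero]
    intro h
    rw [h] at hdS
    have := hMp.det_pos
    linarith
  -- Congruence by the square root of the midpoint `M` makes the pair symmetric about the identity:
  -- `X = S (1 + N) S` and `Y = S (1 - N) S`, so one diagonalisation of `N` serves both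
  -- determinants.
  set N := S⁻¹ * ((1 / 2 : ℝ) • (X - Y)) * S⁻¹ with hNdef
  have hSNS : S * N * S = (1 / 2 : ℝ) • (X - Y) := by
    rw [hNdef]
    calc _ = (S * S⁻¹) * ((1 / 2 : ℝ) • (X - Y)) * (S⁻¹ * S) := by simp only [Matrix.mul_assoc]
      _ = _ := by rw [mul_nonsing_inv _ hSu, nonsing_inv_mul _ hSu]; simp
  have hXe : X = S * (1 + (1 : ℝ) • N) * S := by
    rw [Matrix.mul_add, Matrix.add_mul, Matrix.mul_one, hSS, one_smul, hSNS, hM]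
    module
  have hYe : Y = S * (1 + (-1 : ℝ) • N) * S := by
    rw [Matrix.mul_add, Matrix.add_mul, Matrix.mul_one, hSS, mul_smul_comm, smul_mul_assoc, hSNS, hM]
    module
  have hSi : Sᴴ = S := hSh
  have hNt : Nᵀ = N := by
    have hXt : Xᵀ = X := by simpa [IsHermitian] using hX.1
    have hYt : Yᵀ = Y := by simpa [IsHermitian] using hY.1
    rw [hNdef]
    simp [transpose_mul, transpose_nonsing_inv, hSt, hXt, hYt, Matrix.mul_assoc]
  have hNh : N.IsHermitian := by simpa [IsHermitian] using hNt
  have back : ∀ {Z : Matrix ι ι ℝ}, (S * Z * S).PosDef → Z.PosDef := by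
    intro Z hZ
    have hinj' : Function.Injective S⁻¹.mulVec := mulVec_injective_of_isUnit (by
      rw [isUnit_iff_isUnit_det]; exact isUnit_nonsing_inv_det _ hSu)
    have := hZ.conjTranspose_mul_mul_same hinj'
    rw [conjTranspose_nonsing_inv, hSi] at this
    convert this using 1
    calc Z = (S⁻¹ * S) * Z * (S * S⁻¹) := by
          rw [mul_nonsing_inv _ hSu, nonsing_inv_mul _ hSu]; simp
      _ = _ := by simp only [Matrix.mul_assoc]
  obtain ⟨U, d, h1, h2, h3⟩ := exists_orthogonal_diagonalization hNh
  have hp : ∀ i, 0 < 1 + 1 * d i := posDef_one_add_smul_conj_diagonal h2 h1 (by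
    rw [← h3]; exact back (hXe ▸ hX))
  have hm : ∀ i, 0 < 1 + (-1) * d i := posDef_one_add_smul_conj_diagonal h2 h1 (by
    rw [← h3]; exact back (hYe ▸ hY))
  have hdX : X.det = M.det * ∏ i, (1 + 1 * d i) := by
    rw [hXe, det_mul, det_mul, h3, det_one_add_smul_conj_diagonal h2, ← hdS]; ring
  have hdY : Y.det = M.det * ∏ i, (1 + (-1) * d i) := by
    rw [hYe, det_mul, det_mul, h3, det_one_add_smul_conj_diagonal h2, ← hdS]; ring
  have hMd := hMp.det_pos
  have hlX : Real.log X.det = Real.log M.det + ∑ i, Real.log (1 + 1 * d i) := by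
    rw [hdX, Real.log_mul hMd.ne' (Finset.prod_pos fun i _ => hp i).ne',
      Real.log_prod fun i _ => (hp i).ne']
  have hlY : Real.log Y.det = Real.log M.det + ∑ i, Real.log (1 + (-1) * d i) := by
    rw [hdY, Real.log_mul hMd.ne' (Finset.prod_pos fun i _ => hm i).ne',
      Real.log_prod fun i _ => (hm i).ne']
  have htr : (Nᵀ * N).trace = ∑ i, d i ^ 2 := by
    rw [hNt]
    conv_lhs => rw [h3]
    rw [show U * diagonal d * Uᵀ * (U * diagonal d * Uᵀ)
        = U * (diagonal d * (Uᵀ * U) * diagonal d * Uᵀ) by simp only [Matrix.mul_assoc], h1,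
      trace_mul_comm, Matrix.mul_assoc _ Uᵀ U, h1]
    simp [pow_two]
  -- The factors `det M` cancel and the gap is `-∑ log (1 - d i ^ 2)`, which dominates the squared
  -- Frobenius norm of `N`.
  have key : ∑ i, d i ^ 2 ≤
      2 * Real.log M.det - Real.log X.det - Real.log Y.det := by
    rw [hlX, hlY]
    have : ∑ i, (Real.log (1 + 1 * d i) + Real.log (1 + (-1) * d i)) ≤ ∑ i, -(d i ^ 2) := by
      refine Finset.sum_le_sum fun i _ => ?_
      rw [← Real.log_mul (hp i).ne' (hm i).ne']
      have := Real.log_le_sub_one_of_pos (mul_pos (hp i) (hm i))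
      linarith [this, show (1 + 1 * d i) * (1 + (-1) * d i) = 1 - d i ^ 2 by ring]
    rw [Finset.sum_add_distrib, Finset.sum_neg_distrib] at this
    linarith
  have quad : ∀ w z : ι → ℝ, ∀ Z : Matrix ι ι ℝ, w ⬝ᵥ (S * Z * S) *ᵥ z
      = (S *ᵥ w) ⬝ᵥ Z *ᵥ (S *ᵥ z) := by
    intro w z Z
    rw [← mulVec_mulVec, ← mulVec_mulVec, dotProduct_mulVec, ← mulVec_transpose, hSt]
  have hMu : ∀ w : ι → ℝ, w ⬝ᵥ X *ᵥ w ≤ 2 → w ⬝ᵥ Y *ᵥ w ≤ 2 → (S *ᵥ w) ⬝ᵥ (S *ᵥ w) ≤ 2 := by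
    intro w a b
    have := quad w w 1
    rw [Matrix.mul_one, hSS, one_mulVec] at this
    rw [← this, hM, smul_mulVec, add_mulVec, dotProduct_smul, dotProduct_add, smul_eq_mul]
    linarith
  have hbil : u ⬝ᵥ (X - Y) *ᵥ v = 2 * ((S *ᵥ u) ⬝ᵥ N *ᵥ (S *ᵥ v)) := by
    rw [← quad, hSNS, smul_mulVec, dotProduct_smul, smul_eq_mul]; ring
  have hcs := sq_dotProduct_mulVec_le N (S *ᵥ u) (S *ᵥ v)
  rw [htr] at hcs
  have hprod : ((S *ᵥ u) ⬝ᵥ (S *ᵥ u)) * ((S *ᵥ v) ⬝ᵥ (S *ᵥ v)) ≤ 2 * 2 :=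
    mul_le_mul (hMu u hu hu') (hMu v hv hv') (dotProduct_self_star_nonneg _) (by norm_num)
  have h4 := mul_le_mul_of_nonneg_right hprod 
    (Finset.sum_nonneg fun (i : ι) (_ : i ∈ Finset.univ) => sq_nonneg (d i))
  rw [hbil]
  nlinarith [hcs, h4, key]

end LinearAlgebra

/-! ### Compactness of the decision set and stability of the minimiser. -/

section DecisionSet

theorem abs_apply_le_one_of_posSemidef {ι : Type*} [Fintype ι] [DecidableEq ι] {W : Matrix ι ι ℝ}
    (hW : W.PosSemidef) (hd : ∀ v, W v v ≤ 1) (a b : ι) : |W a b| ≤ 1 := by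
  have hs : W b a = W a b := by
    have := congrFun (congrFun hW.1 a) b
    simpa using this
  have h : ∀ s : ℝ, 0 ≤ W a a + s * (2 * W a b) + s ^ 2 * W b b := by
    intro s
    have := hW.dotProduct_mulVec_nonneg (Pi.single a 1 + s • Pi.single b 1)
    simp only [star_trivial, mulVec_add, mulVec_smul, mulVec_single_one, dotProduct_add,
      add_dotProduct, smul_dotProduct, dotProduct_smul, single_one_dotProduct, col_apply,
      smul_eq_mul, hs] at this
    linarith
  have h1 := h 1
  have h2 := h (-1)
  rw [abs_le]
  constructor <;> linarith [hd a, hd b]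

theorem dotProduct_mulVec_mul_mul {ι : Type*} [Fintype ι] {A : Matrix ι ι ℝ} (hA : A.IsHermitian)
    (B : Matrix ι ι ℝ) (u v : ι → ℝ) : u ⬝ᵥ (A * B * A) *ᵥ v = (A *ᵥ u) ⬝ᵥ B *ᵥ (A *ᵥ v) := by
  have hAt : Aᵀ = A := by simpa [IsHermitian] using hA
  rw [← mulVec_mulVec, ← mulVec_mulVec, dotProduct_mulVec, ← mulVec_transpose, hAt]

/-- A positive semidefinite quadratic form is bounded by the trace. -/
theorem dotProduct_mulVec_le_trace {ι : Type*} [Fintype ι] [DecidableEq ι] {S : Matrix ι ι ℝ}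
    (hS : S.PosSemidef) (u : ι → ℝ) : u ⬝ᵥ S *ᵥ u ≤ (u ⬝ᵥ u) * S.trace := by
  obtain ⟨hB, hBB⟩ := msqrt_mul_self S hS
  set B := msqrt S
  have hq : u ⬝ᵥ S *ᵥ u = ∑ a, (∑ b, B a b * u b) ^ 2 := by
    have := dotProduct_mulVec_mul_mul hB 1 u u
    rw [Matrix.mul_one, hBB, one_mulVec] at this
    rw [this]
    exact Finset.sum_congr rfl fun a _ => (sq _).symm
  have ht : S.trace = ∑ a, ∑ b, B a b ^ 2 := by
    rw [← hBB]
    simp only [Matrix.trace, diag, mul_apply]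
    refine Finset.sum_congr rfl fun a _ => Finset.sum_congr rfl fun b _ => ?_
    have : B b a = B a b := by simpa using congrFun (congrFun hB a) b
    rw [this, sq]
  rw [hq, ht, mul_comm, Finset.sum_mul]
  refine Finset.sum_le_sum fun a _ => ?_
  refine (Finset.sum_mul_sq_le_sq_mul_sq _ _ _).trans_eq ?_
  simp [dotProduct, sq]

theorem posSemidef_conj {ι : Type*} [Fintype ι] {Γ W : Matrix ι ι ℝ} (hΓ : Γ.IsHermitian)
    (hW : W.PosSemidef) : (Γ * W * Γ).PosSemidef := by
  have := hW.mul_mul_conjTranspose_same Γ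
  rwa [hΓ.eq] at this

variable {V : Type*} [Fintype V]

theorem isClosed_setOf_posSemidef {ι : Type*} [Fintype ι] :
    IsClosed {W : Matrix ι ι ℝ | W.PosSemidef} := by
  simp only [posSemidef_iff_dotProduct_mulVec, Set.ofPred_and, Set.ofPred_forall, IsHermitian]
  refine IsClosed.inter (isClosed_eq (by fun_prop) continuous_id) (isClosed_iInter fun x => ?_)
  exact isClosed_le continuous_const (by simp only [dotProduct, mulVec]; fun_prop)

theorem isCompact_decisionSet (Γ : Matrix (V ⊕ V) (V ⊕ V) ℝ) (Dhat : ℝ) :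
    IsCompact (decisionSet Γ Dhat) := by
  classical
  have hc : IsCompact (Set.pi Set.univ fun _ : V ⊕ V => Set.pi Set.univ fun _ : V ⊕ V =>
      Set.Icc (-1 : ℝ) 1) :=
    isCompact_univ_pi fun _ => isCompact_univ_pi fun _ => isCompact_Icc
  refine IsCompact.of_isClosed_subset hc ?_ ?_
  · have h2 : IsClosed {W : Matrix (V ⊕ V) (V ⊕ V) ℝ | ∀ v, W v v ≤ 1} := by
      rw [Set.ofPred_forall]
      exact isClosed_iInter fun v => isClosed_le (by fun_prop) continuous_const
    have h3 : IsClosed {W : Matrix (V ⊕ V) (V ⊕ V) ℝ | (Γ * W * Γ).trace ≤ Dhat} :=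
      isClosed_le (by fun_prop) continuous_const
    exact isClosed_setOf_posSemidef.inter (h2.inter h3)
  · intro W hW a _ b _
    exact abs_le.mp (abs_apply_le_one_of_posSemidef hW.1 hW.2.1 a b)

theorem midpoint_mem_decisionSet {Γ : Matrix (V ⊕ V) (V ⊕ V) ℝ} {Dhat : ℝ}
    {W W' : Matrix (V ⊕ V) (V ⊕ V) ℝ} (h : W ∈ decisionSet Γ Dhat) (h' : W' ∈ decisionSet Γ Dhat) :
    (1 / 2 : ℝ) • (W + W') ∈ decisionSet Γ Dhat := by
  refine ⟨(h.1.add h'.1).smul (by norm_num), fun v => ?_, ?_⟩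
  · simp only [Matrix.smul_apply, Matrix.add_apply, smul_eq_mul]
    linarith [h.2.1 v, h'.2.1 v]
  · simp only [mul_smul_comm, smul_mul_assoc, Matrix.mul_add, Matrix.add_mul, trace_smul, trace_add,
      smul_eq_mul]
    linarith [h.2.2, h'.2.2]

theorem frob_add_right {ι : Type*} [Fintype ι] (W A B : Matrix ι ι ℝ) :
    frob W (A + B) = frob W A + frob W B := by
  simp [frob, Matrix.mul_add]

theorem frob_midpoint {ι : Type*} [Fintype ι] (W W' A : Matrix ι ι ℝ) :
    2 * frob ((1 / 2 : ℝ) • (W + W')) A = frob W A + frob W' A := by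
  simp only [frob, transpose_smul, transpose_add, smul_mul_assoc, Matrix.add_mul, trace_smul,
    trace_add, smul_eq_mul]
  ring

variable [DecidableEq V] {Γ : Matrix (V ⊕ V) (V ⊕ V) ℝ}

theorem posDef_conj_add_one (hΓ : Γ.IsHermitian) {W : Matrix (V ⊕ V) (V ⊕ V) ℝ}
    (hW : W.PosSemidef) : (Γ * W * Γ + 1).PosDef :=
  PosDef.posSemidef_add (posSemidef_conj hΓ hW) PosDef.one

/-- `Γ⁻¹ e_v`, the preimage of a coordinate vector. -/
theorem exists_preimage_single (hΓ : Γ.IsHermitian) (hu : IsUnit Γ.det)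
    (hd : ∀ v, (Γ⁻¹ * Γ⁻¹) v v ≤ 1) (v : V ⊕ V) :
    ∃ g, Γ *ᵥ g = Pi.single v 1 ∧ g ⬝ᵥ g ≤ 1 := by
  refine ⟨Γ⁻¹ *ᵥ Pi.single v 1, by rw [mulVec_mulVec, mul_nonsing_inv _ hu, one_mulVec], ?_⟩
  have := dotProduct_mulVec_mul_mul hΓ.inv 1 (Pi.single v 1) (Pi.single v 1)
  rw [Matrix.mul_one, one_mulVec] at this
  rw [← this]
  simpa using hd v

/-- With `e_v = Γ g`, the entry `W v v` is the form of `Γ W Γ` at `g`, hence at most `|g|² Tr(Γ W Γ)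
≤ Dhat`. This is what lets terms without `Dhat` be absorbed later. -/
theorem one_le_of_mem_decisionSet (hΓ : Γ.IsHermitian) (hu : IsUnit Γ.det)
    (hd : ∀ v, (Γ⁻¹ * Γ⁻¹) v v ≤ 1) {Dhat : ℝ} {W : Matrix (V ⊕ V) (V ⊕ V) ℝ}
    (hW : W ∈ decisionSet Γ Dhat) {v : V ⊕ V} (hv : W v v = 1) : 1 ≤ Dhat := by
  obtain ⟨g, hg, hg1⟩ := exists_preimage_single hΓ hu hd v
  have hS := posSemidef_conj hΓ hW.1
  have h := dotProduct_mulVec_le_trace hS g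
  rw [dotProduct_mulVec_mul_mul hΓ, hg] at h
  simp only [mulVec_single_one, single_one_dotProduct, col_apply, hv] at h
  nlinarith [hS.trace_nonneg, hW.2.2]

/-- The objective is strongly convex along every matrix entry. -/
theorem ftrlObjective_midpoint (hΓ : Γ.IsHermitian) (hu : IsUnit Γ.det)
    (hd : ∀ v, (Γ⁻¹ * Γ⁻¹) v v ≤ 1) {Dhat η : ℝ} {A W W' : Matrix (V ⊕ V) (V ⊕ V) ℝ}
    (hW : W ∈ decisionSet Γ Dhat) (hW' : W' ∈ decisionSet Γ Dhat) (a b : V ⊕ V) :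
    2 * ftrlObjective Γ η A ((1 / 2 : ℝ) • (W + W')) + (W a b - W' a b) ^ 2 / 16 ≤
      ftrlObjective Γ η A W + ftrlObjective Γ η A W' := by
  obtain ⟨g, hg, hg1⟩ := exists_preimage_single hΓ hu hd a
  obtain ⟨f, hf, hf1⟩ := exists_preimage_single hΓ hu hd b
  -- The form equals `Z v v + |w|²`, and both summands are at most `1`.
  have quad : ∀ {Z : Matrix (V ⊕ V) (V ⊕ V) ℝ}, Z ∈ decisionSet Γ Dhat → ∀ {w : V ⊕ V → ℝ}
      {v : V ⊕ V}, Γ *ᵥ w = Pi.single v 1 → w ⬝ᵥ w ≤ 1 → w ⬝ᵥ (Γ * Z * Γ + 1) *ᵥ w ≤ 2 := by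
    intro Z hZ w v hw hw1
    rw [add_mulVec, dotProduct_add, dotProduct_mulVec_mul_mul hΓ, hw, one_mulVec]
    simp only [mulVec_single_one, single_one_dotProduct, col_apply]
    linarith [hZ.2.1 v]
  have h := sq_dotProduct_sub_le_log_det (posDef_conj_add_one hΓ hW.1)
    (posDef_conj_add_one hΓ hW'.1) (quad hW hg hg1) (quad hW' hg hg1) (quad hW hf hf1)
    (quad hW' hf hf1)
  have e1 : (Γ * W * Γ + 1) - (Γ * W' * Γ + 1) = Γ * (W - W') * Γ := by
    rw [Matrix.mul_sub, Matrix.sub_mul]; abel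
  have e2 : (1 / 2 : ℝ) • ((Γ * W * Γ + 1) + (Γ * W' * Γ + 1))
      = Γ * ((1 / 2 : ℝ) • (W + W')) * Γ + 1 := by
    simp only [mul_smul_comm, smul_mul_assoc, Matrix.mul_add, Matrix.add_mul]
    module
  rw [e1, e2, dotProduct_mulVec_mul_mul hΓ, hg, hf] at h
  simp only [mulVec_single_one, single_one_dotProduct, col_apply, Matrix.sub_apply] at h
  simp only [ftrlObjective]
  linear_combination h + η * frob_midpoint W W' A

/-- The midpoint of `W` and `W'` is feasible, so its value is at least that of `W`; inserting this
in midpoint strong convexity leaves the quadratic gain. -/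
theorem IsFTRL.add_sq_le (hΓ : Γ.IsHermitian) (hu : IsUnit Γ.det)
    (hd : ∀ v, (Γ⁻¹ * Γ⁻¹) v v ≤ 1) {Dhat η : ℝ} {A W W' : Matrix (V ⊕ V) (V ⊕ V) ℝ}
    (hW : IsFTRL Γ Dhat η A W) (hW' : W' ∈ decisionSet Γ Dhat) (a b : V ⊕ V) :
    ftrlObjective Γ η A W + (W a b - W' a b) ^ 2 / 16 ≤ ftrlObjective Γ η A W' := by
  have := ftrlObjective_midpoint hΓ hu hd (η := η) (A := A) hW.1 hW' a b
  linarith [hW.2 _ (midpoint_mem_decisionSet hW.1 hW')]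

theorem existsUnique_isFTRL (hΓ : Γ.IsHermitian) (hu : IsUnit Γ.det)
    (hd : ∀ v, (Γ⁻¹ * Γ⁻¹) v v ≤ 1) {Dhat : ℝ} (η : ℝ) (A : Matrix (V ⊕ V) (V ⊕ V) ℝ)
    (hne : (decisionSet Γ Dhat).Nonempty) : ∃! W, IsFTRL Γ Dhat η A W := by
  have hcont : ContinuousOn (ftrlObjective Γ η A) (decisionSet Γ Dhat) := by
    unfold ftrlObjective frob
    refine ContinuousOn.add (ContinuousOn.neg (ContinuousOn.log (by fun_prop) ?_)) (by fun_prop)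
    exact fun W hW => (posDef_conj_add_one hΓ hW.1).det_pos.ne'
  obtain ⟨W, hW, hmin⟩ := (isCompact_decisionSet Γ Dhat).exists_isMinOn hne hcont
  have hWF : IsFTRL Γ Dhat η A W := ⟨hW, fun W' h => hmin h⟩
  refine ⟨W, hWF, fun W' hW' => ?_⟩
  ext a b
  have h1 := hWF.add_sq_le hΓ hu hd hW'.1 a b
  have h2 := hW'.2 W hW
  nlinarith [sq_nonneg (W a b - W' a b)]

end DecisionSet

/-! ### The potential argument for the mistake bound. -/

section Regret

theorem hinge_nonneg {γ : ℝ} (hγ : 0 < γ) (x : ℝ) : 0 ≤ hinge γ x := by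
  unfold hinge
  split_ifs with h
  · exact le_rfl
  · have := (div_le_one hγ).mpr (not_le.mp h).le
    linarith

theorem one_sub_div_le_hinge {γ : ℝ} (hγ : 0 < γ) (x : ℝ) : 1 - x / γ ≤ hinge γ x := by
  unfold hinge
  split_ifs with h
  · have := (one_le_div hγ).mpr h
    linarith
  · exact le_rfl

theorem mistakes_succ (t : ℕ) (lab yhat : ℕ → ℝ) [Decidable (yhat t ≠ lab t)] :
    mistakes (t + 1) lab yhat = mistakes t lab yhat + if yhat t ≠ lab t then 1 else 0 := by
  classical
  simp only [mistakes, Finset.card_filter, Finset.sum_range_succ]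
  congr

variable {V : Type*} [Fintype V] [DecidableEq V] {Γ : Matrix (V ⊕ V) (V ⊕ V) ℝ}

theorem frob_sparseZ {W : Matrix (V ⊕ V) (V ⊕ V) ℝ} (hW : W.IsHermitian) (i j : V) :
    frob W (sparseZ i j) = W (Sum.inl i) (Sum.inr j) := by
  have hs : W (Sum.inr j) (Sum.inl i) = W (Sum.inl i) (Sum.inr j) := by
    simpa using congrFun (congrFun hW (Sum.inl i)) (Sum.inr j)
  have hWt : Wᵀ = W := by simpa [IsHermitian] using hW
  simp only [frob, hWt, sparseZ, mul_smul_comm, Matrix.mul_add, trace_smul, trace_add, smul_eq_mul,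
    trace_mul_single, hs]
  simp only [MulOpposite.op_one, one_smul]
  ring

theorem frob_lossMatrix {W : Matrix (V ⊕ V) (V ⊕ V) ℝ} (hW : W.IsHermitian) (γ : ℝ) (i j : ℕ → V)
    {lab yhat : ℕ → ℝ} {t : ℕ} (h : yhat t ≠ lab t) :
    frob W (lossMatrix γ i j lab yhat t) =
      -(lab t / γ) * W (Sum.inl (i t)) (Sum.inr (j t)) := by
  rw [lossMatrix, if_pos h, ← frob_sparseZ hW]
  simp only [frob, mul_smul_comm, trace_smul, smul_eq_mul]
  ring

theorem ftrlObjective_add (η : ℝ) (A B W : Matrix (V ⊕ V) (V ⊕ V) ℝ) :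
    ftrlObjective Γ η (A + B) W = ftrlObjective Γ η A W + η * frob W B := by
  simp only [ftrlObjective, frob_add_right]
  ring

/-- Lower bound for the minimum of the objective: once a mistake has been made, each further
mistake lowers it by at most `4 c η`. -/
theorem IsRun.potential (hΓ : Γ.IsHermitian) (hu : IsUnit Γ.det)
    (hd : ∀ v, (Γ⁻¹ * Γ⁻¹) v v ≤ 1) {γ c Dhat : ℝ} (hγ : 0 < γ) (hc : 0 < c) {T : ℕ}
    {i j : ℕ → V} {lab yhat : ℕ → ℝ} {W : ℕ → Matrix (V ⊕ V) (V ⊕ V) ℝ}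
    (hlab : ∀ t < T, lab t = 1 ∨ lab t = -1)
    (hrun : IsRun Γ γ Dhat (c * γ ^ 2) T i j lab W yhat) (t : ℕ) (ht : t ≤ T) :
    (∑ s ∈ Finset.range t, lossMatrix γ i j lab yhat s = 0 ∧ mistakes t lab yhat = 0) ∨
      (IsFTRL Γ Dhat (c * γ ^ 2) (∑ s ∈ Finset.range t, lossMatrix γ i j lab yhat s) (W t) ∧
        -Dhat - c * γ - 4 * c * (c * γ ^ 2) * mistakes t lab yhat ≤
          ftrlObjective Γ (c * γ ^ 2) (∑ s ∈ Finset.range t, lossMatrix γ i j lab yhat s) (W t)) := by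
  classical
  induction t with
  | zero => left; simp [mistakes]
  | succ t ih =>
    have ih := ih (by omega)
    rw [mistakes_succ]
    by_cases h : yhat t = lab t
    · rw [Finset.sum_range_succ, hrun.keep t (by omega) h, lossMatrix, if_neg (by simpa using h),
        if_neg (by simpa using h), add_zero, add_zero]
      exact ih
    right
    have hup := hrun.update t (by omega) h
    refine ⟨hup, ?_⟩
    rw [if_pos h, Finset.sum_range_succ, ftrlObjective_add,
      frob_lossMatrix hup.1.1.1 γ i j h]
    have hab := abs_apply_le_one_of_posSemidef hup.1.1 hup.1.2.1 (Sum.inl (i t)) (Sum.inr (j t))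
    set x := W (t + 1) (Sum.inl (i t)) (Sum.inr (j t)) with hx
    have hl2 : lab t ^ 2 = 1 := by rcases hlab t (by omega) with h | h <;> rw [h] <;> norm_num
    have hscale : ∀ z : ℝ, c * γ ^ 2 * (-(lab t / γ) * z) = -(c * γ * (lab t * z)) := by
      intro z; field_simp
    rw [hscale]
    rcases ih with ⟨hA, hm⟩ | ⟨hF, hm⟩
    -- First mistake: the current matrix is arbitrary and minimises nothing, so stability is
    -- unavailable. The crude bounds `log det ≤ Tr ≤ Dhat` and `|x| ≤ 1` give the fixed loss `Dhat +
    -- c γ`.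
    · rw [hA, hm]
      have h1 : -Dhat ≤ ftrlObjective Γ (c * γ ^ 2) 0 (W (t + 1)) := by
        have := (log_det_one_add_bounds (posSemidef_conj hΓ hup.1.1)).2
        simp only [ftrlObjective, frob, trace_zero, mul_zero, add_zero]
        linarith [hup.1.2.2]
      have h2 : lab t * x ≤ 1 := by
        rcases hlab t (by omega) with h | h <;> rw [h] <;> linarith [abs_le.mp hab]
      have h3 := mul_le_mul_of_nonneg_left h2 (by positivity : 0 ≤ c * γ)
      have h4 : 0 < c * (c * γ ^ 2) := by positivity
      push_cast
      linarith
    · have hst := hF.add_sq_le hΓ hu hd hup.1 (Sum.inl (i t)) (Sum.inr (j t))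
      rw [← hx] at hst
      set w := W t (Sum.inl (i t)) (Sum.inr (j t)) with hw
      -- A mistake means that the entry behind the prediction does not have the strict sign of the
      -- label.
      have hwl : lab t * w ≤ 0 := by
        have hz := frob_sparseZ hF.1.1.1 (i t) (j t)
        rw [← hw] at hz
        rcases lt_trichotomy w 0 with h0 | h0 | h0
        · have := hrun.pred_neg t (by omega) (by rw [hz]; exact h0)
          rcases hlab t (by omega) with h' | h'
          · rw [h']; linarith
          · exact absurd (this.trans h'.symm) h
        · simp [h0]
        · have := hrun.pred_pos t (by omega) (by rw [hz]; exact h0)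
          rcases hlab t (by omega) with h' | h'
          · exact absurd (this.trans h'.symm) h
          · rw [h']; linarith
      have h1 := mul_nonpos_of_nonneg_of_nonpos (by positivity : 0 ≤ c * γ) hwl
      -- Completing the square: the quadratic stability gain pays for the linear change from `w` to
      -- `x`, up to `4 c η`.
      have h2 : 0 ≤ (w - x) ^ 2 / 16 + c * γ * lab t * (w - x) + 4 * c * (c * γ ^ 2) := by
        have : (w - x) ^ 2 / 16 + c * γ * lab t * (w - x) + 4 * c * (c * γ ^ 2)
            = ((w - x) / 4 + 2 * (c * γ * lab t)) ^ 2 := by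
          linear_combination (-4 * c ^ 2 * γ ^ 2) * hl2
        rw [this]; positivity
      push_cast
      linarith

/-- The lower bound of `IsRun.potential` is compared with the objective at `Z`, then divided by `η =
c γ ^ 2`; the `1 / γ` is the first-mistake term `c γ`. -/
theorem IsRun.mistakes_le (hΓ : Γ.IsHermitian) (hu : IsUnit Γ.det)
    (hd : ∀ v, (Γ⁻¹ * Γ⁻¹) v v ≤ 1) {γ c Dhat : ℝ} (hγ : 0 < γ) (hc : 0 < c) (hD : 0 ≤ Dhat)
    {T : ℕ} {i j : ℕ → V} {lab yhat : ℕ → ℝ} {W : ℕ → Matrix (V ⊕ V) (V ⊕ V) ℝ}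
    (hlab : ∀ t < T, lab t = 1 ∨ lab t = -1)
    (hrun : IsRun Γ γ Dhat (c * γ ^ 2) T i j lab W yhat)
    {Z : Matrix (V ⊕ V) (V ⊕ V) ℝ} (hZ : Z ∈ decisionSet Γ Dhat) :
    (1 - 4 * c) * mistakes T lab yhat ≤
      ∑ t ∈ Finset.range T, hinge γ (lab t * Z (Sum.inl (i t)) (Sum.inr (j t))) +
        Dhat / (c * γ ^ 2) + 1 / γ := by
  classical
  set H := ∑ t ∈ Finset.range T, hinge γ (lab t * Z (Sum.inl (i t)) (Sum.inr (j t))) with hH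
  have hH0 : 0 ≤ H := Finset.sum_nonneg fun t _ => hinge_nonneg hγ _
  rcases hrun.potential hΓ hu hd hγ hc hlab T le_rfl with ⟨-, hm⟩ | ⟨hF, hm⟩
  · rw [hm]
    have : 0 ≤ H + Dhat / (c * γ ^ 2) + 1 / γ := by positivity
    simpa using this
  have h1 := hF.2 Z hZ
  have hfr : ∀ S : Finset ℕ, frob Z (∑ s ∈ S, lossMatrix γ i j lab yhat s)
      = ∑ s ∈ S, frob Z (lossMatrix γ i j lab yhat s) := by
    intro S
    simp only [frob, Finset.mul_sum, trace_sum]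
  have h2 : frob Z (∑ s ∈ Finset.range T, lossMatrix γ i j lab yhat s) ≤
      H - mistakes T lab yhat := by
    rw [hfr, mistakes, Finset.card_filter]
    push_cast
    rw [hH, ← Finset.sum_sub_distrib]
    refine Finset.sum_le_sum fun t _ => ?_
    split_ifs with h
    · rw [frob_lossMatrix hZ.1.1 γ i j h]
      have := one_sub_div_le_hinge hγ (lab t * Z (Sum.inl (i t)) (Sum.inr (j t)))
      rw [show -(lab t / γ) * Z (Sum.inl (i t)) (Sum.inr (j t)) =
        -(lab t * Z (Sum.inl (i t)) (Sum.inr (j t)) / γ) by ring]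
      linarith
    · rw [lossMatrix, if_neg h]
      simpa [frob] using hinge_nonneg hγ _
  have h3 := (log_det_one_add_bounds (posSemidef_conj hΓ hZ.1)).1
  have hη : 0 < c * γ ^ 2 := by positivity
  have h4 := mul_le_mul_of_nonneg_left h2 hη.le
  simp only [ftrlObjective] at h1 hm
  have h5 : c * γ ^ 2 * ((1 - 4 * c) * mistakes T lab yhat) ≤
      c * γ ^ 2 * (H + Dhat / (c * γ ^ 2) + 1 / γ) := by
    have e : c * γ ^ 2 * (H + Dhat / (c * γ ^ 2) + 1 / γ) = c * γ ^ 2 * H + Dhat + c * γ := by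
      field_simp
    rw [e]
    linarith
  exact le_of_mul_le_mul_left h5 hη

end Regret

/-! ### The side-information matrix `Γ` and its normalisation. -/

section SideInformation

variable {V : Type*} [Fintype V] [DecidableEq V] {M : Matrix V V ℝ}

theorem pinv_eq_inv {A : Matrix V V ℝ} (hA : A.IsHermitian) (hu : IsUnit A.det) :
    pinv A = A⁻¹ := by
  have h := (pinv_penrose A hA).1
  calc pinv A = (A⁻¹ * A) * pinv A * (A * A⁻¹) := by
        rw [mul_nonsing_inv _ hu, nonsing_inv_mul _ hu]; simp
    _ = A⁻¹ * (A * pinv A * A) * A⁻¹ := by simp only [Matrix.mul_assoc]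
    _ = A⁻¹ := by rw [h, nonsing_inv_mul _ hu, Matrix.one_mul]

theorem pinv_apply_le_sqRadius (A : Matrix V V ℝ) (i : V) : pinv A i i ≤ sqRadius A :=
  le_ciSup (f := fun i => pinv A i i) (Set.finite_range _).bddAbove i

theorem sqRadius_pos [Nonempty V] (hM : M.PosDef) : 0 < sqRadius M := by
  obtain ⟨i⟩ := ‹Nonempty V›
  refine lt_of_lt_of_le ?_ (pinv_apply_le_sqRadius M i)
  rw [pinv_eq_inv hM.1 hM.det_pos.ne'.isUnit]
  exact hM.inv.diag_pos

theorem isHermitian_sideGamma [Nonempty V] (hM : M.PosDef) : (sideGamma M M).IsHermitian := by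
  have h := (msqrt_mul_self _ (hM.posSemidef.smul (sqRadius_pos hM).le)).1
  exact IsHermitian.fromBlocks h (by simp) h

theorem sideGamma_mul_self [Nonempty V] (hM : M.PosDef) :
    sideGamma M M * sideGamma M M = fromBlocks (sqRadius M • M) 0 0 (sqRadius M • M) := by
  have h := (msqrt_mul_self _ (hM.posSemidef.smul (sqRadius_pos hM).le)).2
  simp [sideGamma, fromBlocks_multiply, h]

theorem isUnit_det_sideGamma [Nonempty V] (hM : M.PosDef) : IsUnit (sideGamma M M).det := by
  have h := congrArg Matrix.det (sideGamma_mul_self hM)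
  rw [det_mul, det_fromBlocks_zero₂₁] at h
  have := (hM.smul (sqRadius_pos hM)).det_pos
  rw [isUnit_iff_ne_zero]
  intro h0
  rw [h0] at h
  nlinarith

/-- Each block of `Γ⁻²` is `M⁻¹` divided by its own largest diagonal entry. -/
theorem sideGamma_inv_mul_inv_apply_le [Nonempty V] (hM : M.PosDef) (v : V ⊕ V) :
    ((sideGamma M M)⁻¹ * (sideGamma M M)⁻¹) v v ≤ 1 := by
  have hR := sqRadius_pos hM
  have hu : IsUnit M.det := hM.det_pos.ne'.isUnit
  have hinv : fromBlocks ((sqRadius M)⁻¹ • M⁻¹) 0 0 ((sqRadius M)⁻¹ • M⁻¹) *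
      (sideGamma M M * sideGamma M M) = 1 := by
    rw [sideGamma_mul_self hM, fromBlocks_multiply]
    simp [nonsing_inv_mul _ hu, hR.ne', smul_smul]
  rw [← Matrix.mul_inv_rev, inv_eq_left_inv hinv]
  have h : ∀ i, (sqRadius M)⁻¹ * M⁻¹ i i ≤ 1 := fun i => by
    rw [inv_mul_le_one₀ hR, ← pinv_eq_inv hM.1 hu]
    exact pinv_apply_le_sqRadius M i
  rcases v with i | i <;> simpa using h i

end SideInformation

/-! ### Comparators as correlation matrices; the mistake bound against `γ U`. -/

section Gram

theorem hingeLoss_nonneg {V : Type*} {γ : ℝ} (hγ : 0 < γ) (T : ℕ) (i j : ℕ → V) (lab : ℕ → ℝ)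
    (X : Matrix V V ℝ) : 0 ≤ hingeLoss γ T i j lab X :=
  Finset.sum_nonneg fun _ _ => hinge_nonneg hγ _

theorem fromRows_mul_transpose {V : Type*} {d : ℕ} (P Q : Matrix V (Fin d) ℝ) :
    fromRows P Q * (fromRows P Q)ᵀ = fromBlocks (P * Pᵀ) (P * Qᵀ) (Q * Pᵀ) (Q * Qᵀ) := by
  rw [transpose_fromRows, fromRows_mul_fromCols]

theorem RowNormalized.fromRows_mul_transpose_apply {V : Type*} {d : ℕ} {P Q : Matrix V (Fin d) ℝ}
    (hP : RowNormalized P) (hQ : RowNormalized Q) (v : V ⊕ V) :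
    (fromRows P Q * (fromRows P Q)ᵀ) v v = 1 := by
  rw [fromRows_mul_transpose]
  rcases v with i | i
  · simpa [mul_apply, sq] using hP i
  · simpa [mul_apply, sq] using hQ i

variable {V : Type*} [Fintype V] {M : Matrix V V ℝ}

theorem posSemidef_fromRows_mul_transpose {d : ℕ} (P Q : Matrix V (Fin d) ℝ) :
    (fromRows P Q * (fromRows P Q)ᵀ).PosSemidef := by
  simpa using posSemidef_self_mul_conjTranspose (fromRows P Q)

variable [DecidableEq V]

/-- The rows of the square root of `W` are Gram vectors, with columns reindexed by `Fin`. The inner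
dimension is thus bounded, although comparators allow any `d`. -/
theorem exists_rowNormalized_of_posSemidef {W : Matrix (V ⊕ V) (V ⊕ V) ℝ} (hW : W.PosSemidef)
    (hd : ∀ v, W v v = 1) : ∃ (d : ℕ) (P Q : Matrix V (Fin d) ℝ), RowNormalized P ∧
      RowNormalized Q ∧ W = fromRows P Q * (fromRows P Q)ᵀ := by
  obtain ⟨hB, hBB⟩ := msqrt_mul_self W hW
  have hBt : (msqrt W)ᵀ = msqrt W := by simpa [IsHermitian] using hB
  set e := Fintype.equivFin (V ⊕ V)
  set B : Matrix (V ⊕ V) (Fin (Fintype.card (V ⊕ V))) ℝ := (msqrt W).submatrix id e.symm with hBdef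
  have hBW : B * Bᵀ = W := by
    rw [hBdef, transpose_submatrix, submatrix_mul_equiv, hBt, hBB]
    simp
  have hrow : fromRows B.toRows₁ B.toRows₂ = B := fromRows_toRows B
  have hn : ∀ v, ∑ a, B v a ^ 2 = 1 := by
    intro v
    rw [← hd v, ← hBW]
    simp [mul_apply, sq]
  exact ⟨_, B.toRows₁, B.toRows₂, fun i => hn (Sum.inl i), fun i => hn (Sum.inr i),
    by rw [hrow, hBW]⟩

theorem trace_sideGamma_mul_mul [Nonempty V] (hM : M.PosDef) {d : ℕ} (P Q : Matrix V (Fin d) ℝ) :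
    (sideGamma M M * (fromRows P Q * (fromRows P Q)ᵀ) * sideGamma M M).trace =
      sideCost M M P Q := by
  rw [trace_mul_cycle, sideGamma_mul_self hM, fromRows_mul_transpose, fromBlocks_multiply]
  have ht : ∀ A B C D : Matrix V V ℝ, (fromBlocks A B C D).trace = A.trace + D.trace := by
    intro A B C D
    simp [Matrix.trace]
  rw [ht]
  simp only [Matrix.zero_mul, add_zero, zero_add, smul_mul_assoc, trace_smul, smul_eq_mul,
    sideCost]
  rw [← Matrix.mul_assoc, ← Matrix.mul_assoc, trace_mul_cycle, trace_mul_cycle M Q]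

/-- Correlation matrices in the decision set. -/
def gramSet (M : Matrix V V ℝ) (Dhat : ℝ) : Set (Matrix (V ⊕ V) (V ⊕ V) ℝ) :=
  decisionSet (sideGamma M M) Dhat ∩ {W | ∀ v, W v v = 1}

theorem isCompact_gramSet (M : Matrix V V ℝ) (Dhat : ℝ) : IsCompact (gramSet M Dhat) := by
  refine (isCompact_decisionSet _ _).inter_right ?_
  rw [Set.ofPred_forall]
  exact isClosed_iInter fun v => isClosed_eq (by fun_prop) continuous_const

theorem comparators_eq_image [Nonempty V] (hM : M.PosDef) (Dhat : ℝ) :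
    comparators M M Dhat = toBlocks₁₂ '' gramSet M Dhat := by
  ext X
  constructor
  · rintro ⟨d, P, Q, hP, hQ, hc, rfl⟩
    have h1 := hP.fromRows_mul_transpose_apply hQ
    refine ⟨_, ⟨⟨posSemidef_fromRows_mul_transpose P Q, fun v => (h1 v).le, ?_⟩, h1⟩, ?_⟩
    · rwa [trace_sideGamma_mul_mul hM]
    · rw [fromRows_mul_transpose, toBlocks_fromBlocks₁₂]
  · rintro ⟨W, ⟨hW, hd⟩, rfl⟩
    obtain ⟨d, P, Q, hP, hQ, rfl⟩ := exists_rowNormalized_of_posSemidef hW.1 hd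
    refine ⟨d, P, Q, hP, hQ, ?_, ?_⟩
    · have := hW.2.2
      rwa [trace_sideGamma_mul_mul hM] at this
    · rw [fromRows_mul_transpose, toBlocks_fromBlocks₁₂]

/-- The infimum defining the quasi-dimension is attained. -/
theorem smul_mem_comparators_of_quasiDim_le [Nonempty V] (hM : M.PosDef) {γ Dhat : ℝ}
    {U : Matrix V V ℝ} (hne : (quasiDimValues γ M M U).Nonempty)
    (hD : quasiDim γ M M U ≤ Dhat) : γ • U ∈ comparators M M Dhat := by
  set Γ := sideGamma M M
  -- With `Γ = 0` and bound `0` the trace constraint is vacuous, so `S` is the compact set of all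
  -- correlation matrices with off-diagonal block `γ U`.
  set S : Set (Matrix (V ⊕ V) (V ⊕ V) ℝ) :=
    decisionSet 0 0 ∩ ({W | ∀ v, W v v = 1} ∩ {W | toBlocks₁₂ W = γ • U}) with hS
  have hSc : IsCompact S := by
    refine (isCompact_decisionSet _ _).inter_right (IsClosed.inter ?_ ?_)
    · rw [Set.ofPred_forall]
      exact isClosed_iInter fun v => isClosed_eq (by fun_prop) continuous_const
    · refine isClosed_eq ?_ continuous_const
      unfold toBlocks₁₂
      fun_prop
  have hmem : ∀ (d : ℕ) (P Q : Matrix V (Fin d) ℝ), RowNormalized P → RowNormalized Q →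
      P * Qᵀ = γ • U → fromRows P Q * (fromRows P Q)ᵀ ∈ S := by
    intro d P Q hP hQ hPQ
    have h1 := hP.fromRows_mul_transpose_apply hQ
    refine ⟨⟨posSemidef_fromRows_mul_transpose P Q, fun v => (h1 v).le, by simp⟩, h1, ?_⟩
    simp only [Set.mem_ofPred_eq, fromRows_mul_transpose, toBlocks_fromBlocks₁₂, hPQ]
  have hSne : S.Nonempty := by
    obtain ⟨r, d, P, Q, hP, hQ, hPQ, -⟩ := hne
    exact ⟨_, hmem d P Q hP hQ hPQ⟩
  have hcont : Continuous fun W : Matrix (V ⊕ V) (V ⊕ V) ℝ => (Γ * W * Γ).trace := by fun_prop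
  obtain ⟨W, hW, hmin⟩ := hSc.exists_isMinOn hSne hcont.continuousOn
  have hle : (Γ * W * Γ).trace ≤ quasiDim γ M M U := by
    refine le_csInf hne ?_
    rintro r ⟨d, P, Q, hP, hQ, hPQ, rfl⟩
    rw [← trace_sideGamma_mul_mul hM]
    exact hmin (hmem d P Q hP hQ hPQ)
  rw [comparators_eq_image hM]
  exact ⟨W, ⟨⟨hW.1.1, hW.1.2.1, hle.trans hD⟩, hW.2.1⟩, hW.2.2⟩

theorem continuous_hinge {γ : ℝ} (hγ : 0 < γ) : Continuous (hinge γ) := by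
  have : hinge γ = fun x => max 0 (1 - x / γ) := by
    funext x
    unfold hinge
    split_ifs with h
    · rw [max_eq_left]
      have := (one_le_div hγ).mpr h
      linarith
    · rw [max_eq_right]
      have := (div_le_one hγ).mpr (not_le.mp h).le
      linarith
  rw [this]
  fun_prop

theorem minHingeLoss_mem [Nonempty V] (hM : M.PosDef) {γ Dhat : ℝ} (hγ : 0 < γ)
    (hne : (comparators M M Dhat).Nonempty) (T : ℕ) (i j : ℕ → V) (lab : ℕ → ℝ) :
    minHingeLoss γ M M Dhat T i j lab ∈ hingeLoss γ T i j lab '' comparators M M Dhat := by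
  refine IsCompact.sInf_mem ?_ (hne.image _)
  rw [comparators_eq_image hM]
  refine ((isCompact_gramSet M Dhat).image ?_).image ?_
  · unfold toBlocks₁₂
    fun_prop
  · unfold hingeLoss
    have := continuous_hinge hγ
    fun_prop

/-- For `c ≤ 1 / 8`, `(1 + 8 c) (1 - 4 c) ≥ 1`, so dividing by `1 - 4 c` costs a factor at most `1 +
8 c`, itself at most both `1 + δ` and `2`. -/
theorem mistakeBound_of_mem_comparators [Nonempty V] (hM : M.PosDef) {γ Dhat c δ : ℝ} (hγ : 0 < γ)
    (hc : 0 < c) (hc1 : c ≤ 1 / 8) (hcδ : 8 * c ≤ δ) {U : Matrix V V ℝ}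
    (hU : ∀ i j, U i j = 1 ∨ U i j = -1) (hmem : γ • U ∈ comparators M M Dhat) :
    MistakeBound M U γ Dhat (c * γ ^ 2) δ ((2 / c + 2) * Dhat / γ ^ 2) := by
  intro T i j lab W yhat hlab hrun
  have hΓ := isHermitian_sideGamma hM
  have hu := isUnit_det_sideGamma hM
  have hd := sideGamma_inv_mul_inv_apply_le hM
  obtain ⟨X, hX, hXm⟩ := minHingeLoss_mem hM hγ ⟨_, hmem⟩ T i j lab
  rw [comparators_eq_image hM] at hX
  obtain ⟨Z, hZ, rfl⟩ := hX
  obtain ⟨v⟩ := ‹Nonempty V›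
  have hD1 : 1 ≤ Dhat := one_le_of_mem_decisionSet hΓ hu hd hZ.1 (hZ.2 (Sum.inl v))
  have hγ1 : γ ≤ 1 := by
    have hm := hmem
    rw [comparators_eq_image (M := M) (hM := hM)] at hm
    obtain ⟨Y, hY, hYU⟩ := hm
    have h := abs_apply_le_one_of_posSemidef hY.1.1 hY.1.2.1 (Sum.inl v) (Sum.inr v)
    have h' : Y (Sum.inl v) (Sum.inr v) = γ * U v v := congrFun (congrFun hYU v) v
    rw [h'] at h
    rcases hU v v with h0 | h0 <;> rw [h0] at h <;> simp [abs_of_pos hγ] at h <;> exact h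
  have hmain := hrun.mistakes_le hΓ hu hd hγ hc (by linarith) hlab hZ.1
  set m : ℝ := (mistakes T lab yhat : ℝ) with hm
  set H := minHingeLoss γ M M Dhat T i j lab with hH
  change _ ≤ hingeLoss γ T i j lab (toBlocks₁₂ Z) + _ + _ at hmain
  rw [hXm] at hmain
  have hH0 : 0 ≤ H := by rw [← hXm]; exact hingeLoss_nonneg hγ _ _ _ _ _
  have h1 : m ≤ (2 / c + 2) * Dhat / γ ^ 2 + (1 + δ) * H := by
    set q := Dhat / γ ^ 2 with hq
    have hq0 : 0 ≤ q := by positivity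
    have e1 : Dhat / (c * γ ^ 2) = 1 / c * q := by rw [hq]; field_simp
    -- Uses `γ ≤ 1 ≤ Dhat`.
    have e2 : 1 / γ ≤ q := by
      rw [hq, div_le_div_iff₀ hγ (by positivity)]
      nlinarith
    have e3 : (2 / c + 2) * Dhat / γ ^ 2 = 2 * (1 / c * q + q) := by rw [hq]; ring
    have hs : 0 ≤ 1 / c * q + q := by positivity
    rw [e1] at hmain
    rw [e3]
    have hm0 : 0 ≤ m := by positivity
    have h2 : m ≤ (1 + 8 * c) * ((1 - 4 * c) * m) := by nlinarith [mul_nonneg hc.le hm0]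
    have h3 : (1 + 8 * c) * ((1 - 4 * c) * m) ≤ (1 + 8 * c) * (H + (1 / c * q + q)) :=
      mul_le_mul_of_nonneg_left (by linarith) (by positivity)
    nlinarith
  refine ⟨h1, fun hl => ?_⟩
  -- On labels from `U` the comparator `γ U` has margin exactly `γ` in every round.
  have hzero : H ≤ 0 := by
    have hle : H ≤ hingeLoss γ T i j lab (γ • U) :=
      csInf_le ⟨0, by rintro _ ⟨X, -, rfl⟩; exact hingeLoss_nonneg hγ _ _ _ _ _⟩ ⟨_, hmem, rfl⟩
    refine hle.trans_eq (Finset.sum_eq_zero fun t ht => ?_)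
    have hl2 : lab t ^ 2 = 1 := by
      rcases hlab t (Finset.mem_range.mp ht) with h | h <;> rw [h] <;> norm_num
    rw [Matrix.smul_apply, ← hl t (Finset.mem_range.mp ht), smul_eq_mul, hinge, if_pos]
    linear_combination -γ * hl2
  have : H = 0 := le_antisymm hzero hH0
  rw [this] at h1 ⊢
  simpa using h1

theorem MistakeBound.mono {U : Matrix V V ℝ} {γ Dhat η δ B B' : ℝ}
    (h : MistakeBound M U γ Dhat η δ B) (hB : B ≤ B') : MistakeBound M U γ Dhat η δ B' := by
  intro T i j lab W yhat hlab hrun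
  obtain ⟨h1, h2⟩ := h T i j lab W yhat hlab hrun
  exact ⟨by linarith, fun hl => by linarith [h2 hl]⟩

end Gram

/-! ### Laplacian, pseudo-inverse and effective resistance. -/

section Laplacian

/-- Along each edge of the path `t ^ 2 ≥ 2 t - 1`, and the differences telescope. Restricting the
energy to the support lets the induction add one vertex at a time. -/
theorem two_mul_sub_length_le {V : Type*} [DecidableEq V] {G : SimpleGraph V}
    [DecidableRel G.Adj] {u v : V} (p : G.Walk u v) (hp : p.IsPath) (x : V → ℝ) :
    2 * (x u - x v) - p.length ≤ (∑ i ∈ p.support.toFinset, ∑ j ∈ p.support.toFinset,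
      if G.Adj i j then (x i - x j) ^ 2 else 0) / 2 := by
  induction p with
  | nil => simp
  | @cons a b c h q ih =>
    rw [SimpleGraph.Walk.cons_isPath_iff] at hp
    have ih := ih hp.1
    have hnot : a ∉ q.support.toFinset := by simpa using hp.2
    have hb : b ∈ q.support.toFinset := by simp
    rw [SimpleGraph.Walk.support_cons, List.toFinset_cons, Finset.sum_insert hnot,
      Finset.sum_insert hnot, SimpleGraph.Walk.length_cons]
    simp only [Finset.sum_insert hnot, Finset.sum_add_distrib, SimpleGraph.irrefl, if_false]
    have h1 : (x a - x b) ^ 2 ≤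
        ∑ j ∈ q.support.toFinset, if G.Adj a j then (x a - x j) ^ 2 else 0 := by
      refine le_trans ?_ (Finset.single_le_sum (fun j _ => by positivity) hb)
      rw [if_pos h]
    have h2 : ∑ j ∈ q.support.toFinset, (if G.Adj j a then (x j - x a) ^ 2 else 0) =
        ∑ j ∈ q.support.toFinset, if G.Adj a j then (x a - x j) ^ 2 else 0 :=
      Finset.sum_congr rfl fun j _ => by simp only [G.adj_comm j a, sub_sq_comm (x j)]
    rw [h2]
    push_cast
    nlinarith [sq_nonneg (x a - x b - 1)]

variable {V : Type*} [Fintype V]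

theorem card_pos_real [Nonempty V] : (0 : ℝ) < Fintype.card V := by exact_mod_cast Fintype.card_pos

theorem trace_transpose_mul_mul {κ : Type*} [Fintype κ] (A : Matrix V V ℝ) (P : Matrix V κ ℝ) :
    (Pᵀ * A * P).trace = ∑ a, P.col a ⬝ᵥ A *ᵥ P.col a := by
  refine Finset.sum_congr rfl fun a _ => ?_
  rw [diag, Matrix.mul_assoc, mul_apply]
  rfl

variable [DecidableEq V] {G : SimpleGraph V} [DecidableRel G.Adj]

theorem dotProduct_lapMatrix_mulVec (x : V → ℝ) :
    x ⬝ᵥ G.lapMatrix ℝ *ᵥ x = (∑ i, ∑ j, if G.Adj i j then (x i - x j) ^ 2 else 0) / 2 := by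
  rw [← G.lapMatrix_toLinearMap₂' ℝ x, toLinearMap₂'_apply']

theorem trace_lapMatrix {κ : Type*} [Fintype κ] (P : Matrix V κ ℝ) :
    (Pᵀ * G.lapMatrix ℝ * P).trace =
      (∑ i, ∑ j, if G.Adj i j then ∑ a, (P i a - P j a) ^ 2 else 0) / 2 := by
  simp only [trace_transpose_mul_mul, dotProduct_lapMatrix_mulVec, col_apply]
  rw [← Finset.sum_div, Finset.sum_comm]
  congr 1
  refine Finset.sum_congr rfl fun i _ => ?_
  rw [Finset.sum_comm]
  refine Finset.sum_congr rfl fun j _ => ?_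
  split_ifs <;> simp

theorem sum_sq_classMatrix_sub {V : Type*} {k : ℕ} (y : V → Fin k) (i j : V) :
    ∑ s, (classMatrix y i s - classMatrix y j s) ^ 2 = if y i = y j then 0 else 2 := by
  by_cases h : y i = y j
  · simp [classMatrix, h]
  · have : ∀ s, (classMatrix y i s - classMatrix y j s) ^ 2
        = (if y i = s then 1 else 0) + (if y j = s then 1 else 0) := by
      intro s
      by_cases h1 : y i = s <;> by_cases h2 : y j = s <;> simp [classMatrix, h1, h2]
      exact (h (h1.trans h2.symm)).elim
    simp only [this, Finset.sum_add_distrib, Finset.sum_ite_eq, Finset.mem_univ, if_true, if_neg h]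
    norm_num

theorem trace_classMatrix {k : ℕ} (y : V → Fin k) :
    ((classMatrix y)ᵀ * G.lapMatrix ℝ * classMatrix y).trace = 2 * (cutSize G y : ℝ) := by
  classical
  -- The graph of cut edges; its handshake identity counts them.
  let H : SimpleGraph V :=
    { Adj := fun a b => G.Adj a b ∧ y a ≠ y b
      symm := ⟨fun _ _ h => ⟨h.1.symm, h.2.symm⟩⟩
      loopless := ⟨fun _ h => h.2 rfl⟩ }
  have hset : {e ∈ G.edgeSet | ¬ (e.map y).IsDiag} = H.edgeSet := by
    ext e
    induction e with | h a b => simp [H]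
  have hcard : cutSize G y = H.edgeFinset.card := by
    rw [cutSize, hset, ← SimpleGraph.coe_edgeFinset, Set.ncard_coe_finset]
  have hdeg : (2 * (H.edgeFinset.card : ℝ)) = ∑ i, ∑ j, if H.Adj i j then (1 : ℝ) else 0 := by
    have := H.sum_degrees_eq_twice_card_edges
    have h' : (2 * (H.edgeFinset.card : ℝ)) = ∑ i, (H.degree i : ℝ) := by exact_mod_cast this.symm
    rw [h']
    exact Finset.sum_congr rfl fun i _ => H.degree_eq_sum_if_adj i
  rw [hcard, hdeg, trace_lapMatrix, Finset.sum_div]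
  refine Finset.sum_congr rfl fun i _ => ?_
  rw [Finset.sum_div]
  refine Finset.sum_congr rfl fun j _ => ?_
  rw [sum_sq_classMatrix_sub]
  by_cases h1 : G.Adj i j <;> by_cases h2 : y i = y j <;> simp [H, h1, h2]

theorem isHermitian_lapMatrix : (G.lapMatrix ℝ).IsHermitian := (G.posSemidef_lapMatrix ℝ).1

theorem transpose_pinv (A : Matrix V V ℝ) : (pinv A)ᵀ = pinv A := by
  have h : IsSelfAdjoint (pinv A) := cfc_predicate _ A
  simpa [star_eq_conjTranspose] using h.star_eq

theorem isHermitian_pinv (A : Matrix V V ℝ) : (pinv A).IsHermitian := by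
  simpa [IsHermitian] using transpose_pinv A

theorem mul_pinv_comm {A : Matrix V V ℝ} (hA : A.IsHermitian) : A * pinv A = pinv A * A := by
  have hAt : Aᵀ = A := by simpa [IsHermitian] using hA
  have := (pinv_penrose A hA).2.2.1
  rw [transpose_mul, transpose_pinv, hAt] at this
  exact this.symm

theorem posSemidef_pinv {A : Matrix V V ℝ} (hA : A.PosSemidef) : (pinv A).PosSemidef := by
  rw [← (pinv_penrose A hA.1).2.1]
  exact posSemidef_conj (isHermitian_pinv A) hA

theorem pinv_lapMatrix_mulVec_one : pinv (G.lapMatrix ℝ) *ᵥ (fun _ => 1) = 0 := by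
  rw [← (pinv_penrose _ (isHermitian_lapMatrix (G := G))).2.1, Matrix.mul_assoc,
    mul_pinv_comm isHermitian_lapMatrix, ← mulVec_mulVec, ← mulVec_mulVec,
    G.lapMatrix_mulVec_const_eq_zero]
  simp

/-- `L` annihilates this matrix, so by connectedness its columns are constant; by symmetry all
entries agree, and the row sums are `1`. -/
theorem one_sub_pinv_mul_lapMatrix (hG : G.Connected) :
    1 - pinv (G.lapMatrix ℝ) * G.lapMatrix ℝ =
      Matrix.of fun _ _ => (1 / (Fintype.card V : ℝ)) := by
  have := hG.nonempty
  set L := G.lapMatrix ℝ with hL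
  set E := 1 - pinv L * L with hE
  have hLE : L * E = 0 := by
    rw [hE, Matrix.mul_sub, ← Matrix.mul_assoc, (pinv_penrose L isHermitian_lapMatrix).1,
      Matrix.mul_one, sub_self]
  have hEt : Eᵀ = E := by
    rw [hE, transpose_sub, (pinv_penrose L isHermitian_lapMatrix).2.2.2, transpose_one]
  have hcol : ∀ i i' j, E i j = E i' j := by
    intro i i' j
    have h : L *ᵥ E.col j = 0 := by
      ext a
      exact congrFun (congrFun hLE a) j
    exact G.lapMatrix_mulVec_eq_zero_iff_forall_reachable.mp h i i' (hG.preconnected i i')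
  have hrow : ∀ i j j', E i j = E i j' := by
    intro i j j'
    rw [← hEt]
    exact hcol j j' i
  have h1 : E *ᵥ (fun _ => 1) = fun _ => 1 := by
    rw [hE, sub_mulVec, ← mulVec_mulVec, hL, G.lapMatrix_mulVec_const_eq_zero]
    simp
  ext i j
  have h2 : ∑ j', E i j' = 1 := by simpa [mulVec, dotProduct] using congrFun h1 i
  rw [Finset.sum_congr rfl fun j' _ => hrow i j' j] at h2
  simp only [Finset.sum_const, Finset.card_univ, nsmul_eq_mul] at h2
  rw [of_apply, eq_div_iff card_pos_real.ne', mul_comm]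
  exact h2

theorem sqRadius_lapMatrix_pos (hG : G.Connected) [Nontrivial V] :
    0 < sqRadius (G.lapMatrix ℝ) := by
  by_contra hR
  have hP := posSemidef_pinv (G.posSemidef_lapMatrix ℝ)
  have h0 : pinv (G.lapMatrix ℝ) = 0 := by
    rw [← hP.trace_eq_zero_iff]
    exact le_antisymm (Finset.sum_nonpos fun i _ =>
      (pinv_apply_le_sqRadius _ i).trans (not_lt.mp hR)) hP.trace_nonneg
  have h1 := one_sub_pinv_mul_lapMatrix hG
  rw [h0, Matrix.zero_mul, sub_zero] at h1
  obtain ⟨a, b, hab⟩ := exists_pair_ne V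
  have h2 := congrFun (congrFun h1 a) b
  have := hG.nonempty
  have h3 : (0 : ℝ) < 1 / Fintype.card V := one_div_pos.mpr card_pos_real
  rw [one_apply_ne hab, of_apply] at h2
  linarith

/-- `L⁺` and `J` act on complementary subspaces, so the rank-one correction inverts separately. The
explicit inverse raises every diagonal entry of `L⁺` by `R_L`. -/
theorem pdLaplacian_mul (hG : G.Connected) [Nontrivial V] :
    pdLaplacian G * (pinv (G.lapMatrix ℝ) +
      sqRadius (G.lapMatrix ℝ) • Matrix.of fun _ _ => (1 : ℝ)) = 1 := by
  set L := G.lapMatrix ℝ with hL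
  set R := sqRadius L with hR
  set J : Matrix V V ℝ := Matrix.of fun _ _ => (1 : ℝ) with hJ
  have hR0 : 0 < R := sqRadius_lapMatrix_pos hG
  have hn : (0 : ℝ) < Fintype.card V := card_pos_real
  have hLP : L * pinv L = 1 - (1 / (Fintype.card V : ℝ)) • J := by
    have h := one_sub_pinv_mul_lapMatrix hG
    rw [mul_pinv_comm isHermitian_lapMatrix, eq_sub_iff_add_eq, add_comm, ← eq_sub_iff_add_eq, h]
    ext a b
    simp [hJ]
  have hLJ : L * J = 0 := by
    ext a b
    exact congrFun (G.lapMatrix_mulVec_const_eq_zero (R := ℝ)) a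
  have hJP : J * pinv L = 0 := by
    have : pinv L * J = 0 := by
      ext a b
      exact congrFun (pinv_lapMatrix_mulVec_one (G := G)) a
    have h := congrArg transpose this
    rw [transpose_mul, transpose_pinv, transpose_zero] at h
    exact h
  have hJJ : J * J = (Fintype.card V : ℝ) • J := by
    ext a b
    simp [hJ, mul_apply]
  rw [pdLaplacian, Matrix.add_mul, Matrix.mul_add, Matrix.mul_add, hLP, mul_smul_comm, hLJ,
    smul_mul_assoc, hJP, smul_mul_smul_comm, hJJ, smul_smul]
  have : R⁻¹ * (1 / (Fintype.card V : ℝ) ^ 2) * R * Fintype.card V = 1 / Fintype.card V := by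
    field_simp
  rw [this]
  simp

theorem posDef_pdLaplacian (hG : G.Connected) [Nontrivial V] : (pdLaplacian G).PosDef := by
  have hR := sqRadius_lapMatrix_pos hG
  have hJ : (Matrix.of fun _ _ => (1 : ℝ) : Matrix V V ℝ).PosSemidef := by
    have := posSemidef_vecMulVec_self_star (fun _ : V => (1 : ℝ))
    convert this using 1
    ext a b
    simp [vecMulVec]
  have hp : (pdLaplacian G).PosSemidef :=
    (G.posSemidef_lapMatrix ℝ).add (hJ.smul (by positivity))
  rw [hp.posDef_iff_isUnit, isUnit_iff_isUnit_det]
  exact isUnit_det_of_right_inverse (pdLaplacian_mul hG)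

theorem sqRadius_pdLaplacian (hG : G.Connected) [Nontrivial V] :
    sqRadius (pdLaplacian G) = 2 * sqRadius (G.lapMatrix ℝ) := by
  have hp := posDef_pdLaplacian hG
  have hR : sqRadius (pdLaplacian G) =
      ⨆ i, (pinv (G.lapMatrix ℝ) i i + sqRadius (G.lapMatrix ℝ)) := by
    rw [sqRadius, pinv_eq_inv hp.1 hp.det_pos.ne'.isUnit, inv_eq_right_inv (pdLaplacian_mul hG)]
    simp
  rw [hR, ← ciSup_add (Set.finite_range _).bddAbove, two_mul]
  rfl

theorem effRes_eq (i j : V) : effRes G i j = pinv (G.lapMatrix ℝ) i i +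
    pinv (G.lapMatrix ℝ) j j - 2 * pinv (G.lapMatrix ℝ) i j := by
  have h : pinv (G.lapMatrix ℝ) j i = pinv (G.lapMatrix ℝ) i j :=
    congrFun (congrFun (transpose_pinv (G.lapMatrix ℝ)) i) j
  simp only [effRes, mulVec_sub, mulVec_single_one, dotProduct_sub, sub_dotProduct,
    single_one_dotProduct, col_apply, h]
  ring

theorem effRes_le_resDiam (i j : V) : effRes G i j ≤ resDiam G :=
  le_ciSup (f := fun p : V × V => effRes G p.1 p.2) (Set.finite_range _).bddAbove (i, j)

/-- Averaging `r_ij` over `j` gives `L⁺_ii + Tr(L⁺) / n`, because the rows of `L⁺` sum to zero. -/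
theorem sqRadius_le_resDiam (G : SimpleGraph V) [DecidableRel G.Adj] [Nonempty V] :
    sqRadius (G.lapMatrix ℝ) ≤ resDiam G := by
  refine ciSup_le fun i => ?_
  have h1 : ∑ j, effRes G i j ≤ ∑ _j : V, resDiam G :=
    Finset.sum_le_sum fun j _ => effRes_le_resDiam i j
  have h2 : ∑ j, pinv (G.lapMatrix ℝ) i j = 0 := by
    simpa [mulVec, dotProduct] using congrFun (pinv_lapMatrix_mulVec_one (G := G)) i
  have h3 := (posSemidef_pinv (G.posSemidef_lapMatrix ℝ)).trace_nonneg
  simp only [effRes_eq, Finset.sum_sub_distrib, Finset.sum_add_distrib, ← Finset.mul_sum, h2,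
    Finset.sum_const, Finset.card_univ, nsmul_eq_mul] at h1
  simp only [Matrix.trace, diag] at h3
  exact le_of_mul_le_mul_left (by linarith) (card_pos_real (V := V))

/-- Positivity of `L⁺` at `e_i + e_j` bounds the cross term, so `r_ij ≤ 2 (L⁺_ii + L⁺_jj)`. -/
theorem effRes_le (i j : V) : effRes G i j ≤ 4 * sqRadius (G.lapMatrix ℝ) := by
  have h := (posSemidef_pinv (G.posSemidef_lapMatrix ℝ)).dotProduct_mulVec_nonneg
    (Pi.single i 1 + Pi.single j 1)
  have hs : pinv (G.lapMatrix ℝ) j i = pinv (G.lapMatrix ℝ) i j :=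
    congrFun (congrFun (transpose_pinv (G.lapMatrix ℝ)) i) j
  simp only [star_trivial, mulVec_add, mulVec_single_one, dotProduct_add, add_dotProduct,
    single_one_dotProduct, col_apply, hs] at h
  rw [effRes_eq]
  linarith [pinv_apply_le_sqRadius (G.lapMatrix ℝ) i, pinv_apply_le_sqRadius (G.lapMatrix ℝ) j]

theorem resDiam_le (G : SimpleGraph V) [DecidableRel G.Adj] [Nonempty V] :
    resDiam G ≤ 4 * sqRadius (G.lapMatrix ℝ) :=
  ciSup_le fun p => effRes_le p.1 p.2

/-- The potential of the unit current flow from `i` to `j`. -/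
theorem exists_potential (hG : G.Connected) (i j : V) :
    ∃ w : V → ℝ, w i - w j = effRes G i j ∧ ∀ z, w ⬝ᵥ G.lapMatrix ℝ *ᵥ z = z i - z j := by
  set d : V → ℝ := Pi.single i 1 - Pi.single j 1 with hd
  refine ⟨pinv (G.lapMatrix ℝ) *ᵥ d, ?_, fun z => ?_⟩
  · rw [effRes, ← hd]
    simp [hd, sub_dotProduct]
  · have h := congrArg (fun A => d ⬝ᵥ A *ᵥ z) (one_sub_pinv_mul_lapMatrix hG)
    simp only [sub_mulVec, one_mulVec, dotProduct_sub, ← mulVec_mulVec] at h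
    rw [dotProduct_mulVec, ← mulVec_transpose, transpose_pinv] at h
    have h0 : d ⬝ᵥ (Matrix.of fun _ _ => (1 / (Fintype.card V : ℝ)) : Matrix V V ℝ) *ᵥ z = 0 := by
      simp [hd, sub_dotProduct, mulVec]
    rw [h0, sub_eq_zero] at h
    rw [← h]
    simp [hd, sub_dotProduct]

/-- Dirichlet's principle: nonnegativity of the energy of `x - t w`, with `w` the unit-current
potential, for all `t`. -/
theorem one_le_effRes_mul (hG : G.Connected) {i j : V} {x : V → ℝ} (hx : x i - x j = 1) :
    1 ≤ effRes G i j * (x ⬝ᵥ G.lapMatrix ℝ *ᵥ x) := by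
  obtain ⟨w, hw, hwz⟩ := exists_potential hG i j
  have hL := G.posSemidef_lapMatrix ℝ
  have hsym : x ⬝ᵥ G.lapMatrix ℝ *ᵥ w = w ⬝ᵥ G.lapMatrix ℝ *ᵥ x := by
    have hLt : (G.lapMatrix ℝ)ᵀ = G.lapMatrix ℝ := by simpa [IsHermitian] using hL.1
    rw [dotProduct_mulVec, ← mulVec_transpose, hLt, dotProduct_comm]
  have hq : ∀ t : ℝ, 0 ≤ x ⬝ᵥ G.lapMatrix ℝ *ᵥ x - 2 * t + t ^ 2 * effRes G i j := by
    intro t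
    have h := hL.dotProduct_mulVec_nonneg (x - t • w)
    simp only [star_trivial, mulVec_sub, mulVec_smul, dotProduct_sub, sub_dotProduct,
      smul_dotProduct, dotProduct_smul, smul_eq_mul, hsym, hwz, hx, hw] at h
    linarith
  set E := x ⬝ᵥ G.lapMatrix ℝ *ᵥ x
  set r := effRes G i j
  have hE := hL.dotProduct_mulVec_nonneg x
  rw [star_trivial] at hE
  have hr : 0 ≤ r := by
    have := hL.dotProduct_mulVec_nonneg w
    rwa [star_trivial, hwz, hw] at this
  have hr1 : (0 : ℝ) < r + 1 := by linarith
  have hE0 : 0 < E := by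
    refine lt_of_le_of_ne hE fun h0 => ?_
    -- This `t` excludes zero energy without assuming `r > 0`.
    have h1 := hq (1 / (r + 1))
    rw [← h0] at h1
    have h2 : 0 - 2 * (1 / (r + 1)) + (1 / (r + 1)) ^ 2 * r = -((r + 2) / (r + 1) ^ 2) := by
      field_simp; ring
    rw [h2] at h1
    have : 0 < (r + 2) / (r + 1) ^ 2 := by positivity
    linarith
  have h1 := hq E
  by_contra hlt
  nlinarith

/-- The unit-current potential has energy equal to its own drop `r`, so the path inequality along a
geodesic reads `2 r - dist ≤ r`. -/
theorem effRes_le_dist (hG : G.Connected) (u v : V) : effRes G u v ≤ G.dist u v := by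
  obtain ⟨w, hw, hwz⟩ := exists_potential hG u v
  obtain ⟨p, hp, hl⟩ := hG.exists_path_of_dist u v
  have h1 := two_mul_sub_length_le p hp w
  have h2 := hwz w
  rw [dotProduct_lapMatrix_mulVec] at h2
  have h0 : ∀ i j, 0 ≤ if G.Adj i j then (w i - w j) ^ 2 else 0 := fun i j => by positivity
  have h3 : (∑ i ∈ p.support.toFinset, ∑ j ∈ p.support.toFinset,
      if G.Adj i j then (w i - w j) ^ 2 else 0) ≤
      ∑ i, ∑ j, if G.Adj i j then (w i - w j) ^ 2 else 0 :=
    (Finset.sum_le_sum fun i _ => Finset.sum_le_sum_of_subset_of_nonneg (Finset.subset_univ _)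
      fun j _ _ => h0 i j).trans (Finset.sum_le_sum_of_subset_of_nonneg (Finset.subset_univ _)
      fun i _ _ => Finset.sum_nonneg fun j _ => h0 i j)
  rw [hl] at h1
  linarith

end Laplacian

/-! ### Class-constant factorisations and the explicit quasi-dimension bound. -/

section Classes

theorem classMatrix_mul_mul_transpose_apply {V : Type*} {k : ℕ} (y : V → Fin k)
    (A : Matrix (Fin k) (Fin k) ℝ) (i j : V) :
    (classMatrix y * A * (classMatrix y)ᵀ) i j = A (y i) (y j) := by
  simp [classMatrix, mul_apply]

/-- Here `γ U = 2 γ R Rᵀ - γ J`. The columns `b` and `-b` produce `-γ J`, while `z`, placed in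
different columns for `P` and `Q`, only pads norms: `2 γ + γ + (1 - 3 γ) = 1`, whence the limit `1 /
3`. -/
theorem exists_rowNormalized_simMatrix {V : Type*} {k : ℕ} (y : V → Fin k) {γ : ℝ} (hγ : 0 < γ)
    (hγ' : γ ≤ 1 / 3) : ∃ P Q : Matrix V (Fin (k + 3)) ℝ, RowNormalized P ∧ RowNormalized Q ∧
      P * Qᵀ = γ • simMatrix y := by
  set s := √(2 * γ)
  set b := √γ
  set z := √(1 - 3 * γ)
  have hs2 : s * s = 2 * γ := Real.mul_self_sqrt (by linarith)
  have hb2 : b * b = γ := Real.mul_self_sqrt hγ.le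
  have hz2 : z * z = 1 - 3 * γ := Real.mul_self_sqrt (by linarith)
  refine ⟨(fromCols (s • classMatrix y) (of fun _ => ![b, z, 0])).submatrix id finSumFinEquiv.symm,
    (fromCols (s • classMatrix y) (of fun _ => ![-b, 0, z])).submatrix id finSumFinEquiv.symm,
    fun i => ?_, fun i => ?_, ?_⟩
  · rw [← finSumFinEquiv.sum_comp]
    simp [Fintype.sum_sum_type, Fin.sum_univ_three, classMatrix, sq, hs2, hb2, hz2]
    ring
  · rw [← finSumFinEquiv.sum_comp]
    simp [Fintype.sum_sum_type, Fin.sum_univ_three, classMatrix, sq, hs2, hb2, hz2]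
    ring
  · ext i j
    rw [mul_apply, ← finSumFinEquiv.sum_comp]
    by_cases h : y i = y j
    · simp [Fintype.sum_sum_type, Fin.sum_univ_three, classMatrix, simMatrix, hs2, hb2, h]
      ring
    · simp [Fintype.sum_sum_type, Fin.sum_univ_three, classMatrix, simMatrix, hs2, hb2, h]

/-- A feasible factorisation can be chosen constant on the classes. -/
theorem exists_factorization_constant_on_classes {V : Type*} [Fintype V] [Nonempty V] {k d : ℕ}
    (y : V → Fin k) (Ustar : Matrix (Fin k) (Fin k) ℝ) {γ : ℝ} {P Q : Matrix V (Fin d) ℝ}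
    (hP : RowNormalized P) (hQ : RowNormalized Q)
    (hPQ : P * Qᵀ = γ • (classMatrix y * Ustar * (classMatrix y)ᵀ)) :
    ∃ P' Q' : Matrix V (Fin d) ℝ, RowNormalized P' ∧ RowNormalized Q' ∧
      P' * Q'ᵀ = γ • (classMatrix y * Ustar * (classMatrix y)ᵀ) ∧
      (∀ i j, y i = y j → P' i = P' j) ∧ ∀ i j, y i = y j → Q' i = Q' j := by
  set ρ : V → V := fun i => Function.invFun y (y i) with hρ
  have hy : ∀ i, y (ρ i) = y i := fun i => Function.invFun_eq ⟨i, rfl⟩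
  have hc : ∀ i j, y i = y j → ρ i = ρ j := fun i j h => by simp [hρ, h]
  refine ⟨P.submatrix ρ id, Q.submatrix ρ id, fun i => hP (ρ i), fun i => hQ (ρ i), ?_,
    fun i j h => ?_, fun i j h => ?_⟩
  · ext i j
    have := congrFun (congrFun hPQ (ρ i)) (ρ j)
    rw [Matrix.smul_apply, classMatrix_mul_mul_transpose_apply, hy, hy] at this
    rw [Matrix.smul_apply, classMatrix_mul_mul_transpose_apply, ← this]
    simp [mul_apply]
  · ext a
    simp [hc i j h]
  · ext a
    simp [hc i j h]

theorem trace_ones_le {V : Type*} [Fintype V] {d : ℕ} {P : Matrix V (Fin d) ℝ} (hP : RowNormalized P) :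
    (Pᵀ * (of fun _ _ => (1 : ℝ) : Matrix V V ℝ) * P).trace ≤ (Fintype.card V : ℝ) ^ 2 := by
  rw [trace_transpose_mul_mul]
  have h : ∀ a, P.col a ⬝ᵥ (of fun _ _ => (1 : ℝ) : Matrix V V ℝ) *ᵥ P.col a ≤
      Fintype.card V * ∑ i, P i a ^ 2 := by
    intro a
    refine le_trans (le_of_eq ?_) (sq_sum_le_card_mul_sum_sq (s := Finset.univ))
    simp only [dotProduct, mulVec, of_apply, one_mul, col_apply]
    rw [← Finset.sum_mul, sq]
  refine (Finset.sum_le_sum fun a _ => h a).trans (le_of_eq ?_)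
  rw [← Finset.mul_sum, Finset.sum_comm, Finset.sum_congr rfl fun i _ => hP i]
  simp [sq]

variable {V : Type*} [Fintype V] [DecidableEq V] {G : SimpleGraph V} [DecidableRel G.Adj]

theorem cutComplexity_eq {k : ℕ} (y : V → Fin k) :
    cutComplexity G y = 2 * cutSize G y * sqRadius (G.lapMatrix ℝ) := by
  rw [cutComplexity, trace_classMatrix]

/-- Unit rows differ by at most `4` in squared distance across a cut edge, indicator rows by exactly
`2`. -/
theorem trace_lapMatrix_le_of_constant_on_classes {k d : ℕ} {y : V → Fin k}
    {P : Matrix V (Fin d) ℝ} (hP : RowNormalized P) (hc : ∀ i j, y i = y j → P i = P j) :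
    (Pᵀ * G.lapMatrix ℝ * P).trace ≤
      2 * ((classMatrix y)ᵀ * G.lapMatrix ℝ * classMatrix y).trace := by
  rw [trace_lapMatrix, trace_lapMatrix, ← mul_div_assoc, Finset.mul_sum]
  refine div_le_div_of_nonneg_right (Finset.sum_le_sum fun i _ => ?_) two_pos.le
  rw [Finset.mul_sum]
  refine Finset.sum_le_sum fun j _ => ?_
  split_ifs with h
  · rw [sum_sq_classMatrix_sub]
    split_ifs with hy
    · simp [hc i j hy]
    · have h1 : ∑ a, (P i a - P j a) ^ 2 ≤ ∑ a, (2 * P i a ^ 2 + 2 * P j a ^ 2) :=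
        Finset.sum_le_sum fun a _ => by nlinarith [sq_nonneg (P i a + P j a)]
      rw [Finset.sum_add_distrib, ← Finset.mul_sum, ← Finset.mul_sum, hP i, hP j] at h1
      linarith
  · simp

/-- The squared radius is `2 R_L`: the Laplacian part gives `2 R_L · 2 Tr(Rᵀ L R)`, and the all-ones
part at most `2`. -/
theorem sqRadius_mul_trace_pdLaplacian_le (hG : G.Connected) [Nontrivial V] {k d : ℕ}
    {y : V → Fin k} {P : Matrix V (Fin d) ℝ} (hP : RowNormalized P)
    (hc : ∀ i j, y i = y j → P i = P j) :
    sqRadius (pdLaplacian G) * (Pᵀ * pdLaplacian G * P).trace ≤ 4 * cutComplexity G y + 2 := by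
  have hR := sqRadius_lapMatrix_pos hG
  have hn : (0 : ℝ) < Fintype.card V := card_pos_real
  have h1 := trace_lapMatrix_le_of_constant_on_classes (G := G) hP hc
  have h2 := trace_ones_le hP
  rw [sqRadius_pdLaplacian hG, pdLaplacian, cutComplexity, Matrix.mul_add, Matrix.add_mul,
    trace_add, Matrix.mul_smul, Matrix.smul_mul, trace_smul, smul_eq_mul]
  set R := sqRadius (G.lapMatrix ℝ)
  have h3 : R * (R⁻¹ * (1 / (Fintype.card V : ℝ) ^ 2) *
      (Pᵀ * (of fun _ _ => (1 : ℝ) : Matrix V V ℝ) * P).trace) ≤ 1 := by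
    rw [← mul_assoc, ← mul_assoc, mul_inv_cancel₀ hR.ne', one_mul, one_div,
      inv_mul_le_one₀ (by positivity)]
    exact h2
  have h4 := mul_le_mul_of_nonneg_left h1 hR.le
  linarith

theorem sideCost_nonneg {M : Matrix V V ℝ} [Nonempty V] (hM : M.PosDef) {d : ℕ}
    (P Q : Matrix V (Fin d) ℝ) : 0 ≤ sideCost M M P Q := by
  have hR := sqRadius_pos hM
  have h : ∀ P : Matrix V (Fin d) ℝ, 0 ≤ (Pᵀ * M * P).trace := fun P => by
    simpa using (hM.posSemidef.conjTranspose_mul_mul_same P).trace_nonneg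
  exact add_nonneg (mul_nonneg hR.le (h P)) (mul_nonneg hR.le (h Q))

theorem quasiDim_le (hG : G.Connected) [Nontrivial V] {k : ℕ} (y : V → Fin k)
    (Ustar : Matrix (Fin k) (Fin k) ℝ) {γ : ℝ}
    (hne : (quasiDimValues γ (pdLaplacian G) (pdLaplacian G)
      (classMatrix y * Ustar * (classMatrix y)ᵀ)).Nonempty) :
    quasiDim γ (pdLaplacian G) (pdLaplacian G) (classMatrix y * Ustar * (classMatrix y)ᵀ) ≤
      8 * cutComplexity G y + 4 := by
  obtain ⟨r, d, P, Q, hP, hQ, hPQ, -⟩ := hne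
  obtain ⟨P', Q', hP', hQ', hPQ', hcP, hcQ⟩ :=
    exists_factorization_constant_on_classes y Ustar hP hQ hPQ
  have hbdd : BddBelow (quasiDimValues γ (pdLaplacian G) (pdLaplacian G)
      (classMatrix y * Ustar * (classMatrix y)ᵀ)) := by
    refine ⟨0, ?_⟩
    rintro _ ⟨d, P, Q, -, -, -, rfl⟩
    exact sideCost_nonneg (posDef_pdLaplacian hG) P Q
  refine (csInf_le hbdd ⟨d, P', Q', hP', hQ', hPQ', rfl⟩).trans ?_
  have h1 := sqRadius_mul_trace_pdLaplacian_le hG hP' hcP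
  have h2 := sqRadius_mul_trace_pdLaplacian_le hG hQ' hcQ
  rw [sideCost]
  linarith

/-- The indicator of one class drops by `1` from `u` to `v`, so Dirichlet's principle applies with
resistance at most `4 R_L`; its energy is one summand of the trace. -/
theorem one_le_four_mul_cutComplexity (hG : G.Connected) {k : ℕ} {y : V → Fin k} {u v : V}
    (huv : y u ≠ y v) : 1 ≤ 4 * cutComplexity G y := by
  have := hG.nonempty
  set x : V → ℝ := (classMatrix y).col (y u) with hx
  have h1 := one_le_effRes_mul hG (x := x) (i := u) (j := v)
    (by simp [hx, classMatrix, Ne.symm huv])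
  have hpos : ∀ s, 0 ≤ (classMatrix y).col s ⬝ᵥ G.lapMatrix ℝ *ᵥ (classMatrix y).col s := fun s => by
    simpa using (G.posSemidef_lapMatrix ℝ).dotProduct_mulVec_nonneg ((classMatrix y).col s)
  have h2 : x ⬝ᵥ G.lapMatrix ℝ *ᵥ x ≤
      ((classMatrix y)ᵀ * G.lapMatrix ℝ * classMatrix y).trace := by
    rw [trace_transpose_mul_mul]
    exact Finset.single_le_sum (f := fun s => (classMatrix y).col s ⬝ᵥ
      G.lapMatrix ℝ *ᵥ (classMatrix y).col s) (fun s _ => hpos s) (Finset.mem_univ (y u))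
  have h3 := effRes_le (G := G) u v
  have hx0 : 0 ≤ x ⬝ᵥ G.lapMatrix ℝ *ᵥ x := hpos _
  have hr : 0 < 4 * sqRadius (G.lapMatrix ℝ) := by
    by_contra h
    nlinarith
  rw [cutComplexity]
  nlinarith [mul_le_mul_of_nonneg_right h3 hx0, mul_le_mul_of_nonneg_left h2 hr.le]

theorem resDiam_le_of_dist_le (hG : G.Connected) {d : ℕ} (hd : ∀ u v, G.dist u v ≤ d) :
    resDiam G ≤ d := by
  have := hG.nonempty
  exact ciSup_le fun p => (effRes_le_dist hG p.1 p.2).trans (by exact_mod_cast hd p.1 p.2)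

end Classes

end OnlineSimilarity

/-! ### Choice of constants and assembly. -/

theorem mainTheorem5 :
    ∀ δ : ℝ, 0 < δ → ∃ c₀ : ℝ, 0 < c₀ ∧ ∀ c : ℝ, 0 < c → c ≤ c₀ → ∃ C : ℝ, 0 < C ∧
      ∀ (n : ℕ), 2 ≤ n → ∀ (G : SimpleGraph (Fin n)) [DecidableRel G.Adj], G.Connected →
      ∀ Lbar : Matrix (Fin n) (Fin n) ℝ, Lbar = pdLaplacian G →
      ∀ (k : ℕ) (y : Fin n → Fin k),
        -- trace and radius against cut-size and resistance diameter
        (((classMatrix y)ᵀ * G.lapMatrix ℝ * classMatrix y).trace = 2 * (cutSize G y : ℝ) ∧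
          sqRadius (G.lapMatrix ℝ) ≤ resDiam G ∧
          resDiam G ≤ 4 * sqRadius (G.lapMatrix ℝ)) ∧
        -- margins up to `1/3` are feasible for the similarity matrix of the classes
        (∀ γ : ℝ, 0 < γ → γ ≤ 1 / 3 →
          (quasiDimValues γ Lbar Lbar (simMatrix y)).Nonempty) ∧
        ∀ (Ustar : Matrix (Fin k) (Fin k) ℝ) (U : Matrix (Fin n) (Fin n) ℝ),
          (∀ r s, Ustar r s = 1 ∨ Ustar r s = -1) →
          U = classMatrix y * Ustar * (classMatrix y)ᵀ →
        ∀ γ : ℝ, 0 < γ →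
          (quasiDimValues γ Lbar Lbar U).Nonempty →
        -- any estimate of the quasi-dimension
        (∀ Dhat : ℝ,
          quasiDim γ Lbar Lbar U ≤ Dhat →
          (∀ A : Matrix (Fin n ⊕ Fin n) (Fin n ⊕ Fin n) ℝ, ∃! W,
            IsFTRL (sideGamma Lbar Lbar) Dhat (c * γ ^ 2) A W) ∧
          γ • U ∈ comparators Lbar Lbar Dhat ∧
          (∀ (T : ℕ) (i j : ℕ → Fin n) (lab : ℕ → ℝ),
            minHingeLoss γ Lbar Lbar Dhat T i j lab ∈
            hingeLoss γ T i j lab '' comparators Lbar Lbar Dhat) ∧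
          MistakeBound Lbar U γ Dhat (c * γ ^ 2) δ
            (C * Dhat / γ ^ 2)) ∧
        -- the explicit estimate `8 Tr(Rᵀ L R) R_L + 4`
        ∀ Dhat : ℝ, Dhat = 8 * cutComplexity G y + 4 →
          quasiDim γ Lbar Lbar U ≤ Dhat ∧
          ((∃ u v, y u ≠ y v) →
            MistakeBound Lbar U γ Dhat (c * γ ^ 2) δ
              (C * cutComplexity G y / γ ^ 2) ∧
            MistakeBound Lbar U γ Dhat (c * γ ^ 2) δ
              (C * ((cutSize G y : ℝ) * resDiam G) / γ ^ 2)) ∧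
          (∀ a : ℝ, cutComplexity G y ≤ a * (k : ℝ) →
            MistakeBound Lbar U γ Dhat (c * γ ^ 2) δ
              (C * (a + 1) * (k : ℝ) / γ ^ 2)) ∧
          (∀ (a : ℝ) (d : ℕ), (cutSize G y : ℝ) ≤ a * (k : ℝ) →
            (∀ u v, G.dist u v ≤ d) →
            MistakeBound Lbar U γ Dhat (c * γ ^ 2) δ
              (C * (a * (d : ℝ) + 1) * (k : ℝ) / γ ^ 2)) := by
  intro δ hδ
  -- With `K = Tr(Rᵀ L R) R_L`, the worst case behind `48` is `8 K + 4 ≤ 24 K ≤ 48 |Φ| r_G`, from `1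
  -- ≤ 4 K` and `K ≤ 2 |Φ| r_G`.
  refine ⟨min 1 δ / 8, by positivity, fun c hc hcle => ⟨48 * (2 / c + 2), by positivity, ?_⟩⟩
  have hc1 : c ≤ 1 / 8 := by linarith [min_le_left 1 δ]
  have hcδ : 8 * c ≤ δ := by linarith [min_le_right 1 δ]
  intro n hn G _ hG Lbar hLbar k y
  subst hLbar
  have : Nontrivial (Fin n) := Fin.nontrivial_iff_two_le.mpr hn
  have hM := posDef_pdLaplacian hG
  have hR := sqRadius_lapMatrix_pos hG
  have hRr := sqRadius_le_resDiam G
  refine ⟨⟨trace_classMatrix y, hRr, resDiam_le G⟩, fun γ hγ hγ' => ?_, ?_⟩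
  · obtain ⟨P, Q, hP, hQ, hPQ⟩ := exists_rowNormalized_simMatrix y hγ hγ'
    exact ⟨_, _, P, Q, hP, hQ, hPQ, rfl⟩
  intro Ustar U hUstar hU γ hγ hne
  have hU1 : ∀ i j, U i j = 1 ∨ U i j = -1 := fun i j => by
    rw [hU, classMatrix_mul_mul_transpose_apply]
    exact hUstar _ _
  have hbound : ∀ Dhat Y : ℝ, quasiDim γ (pdLaplacian G) (pdLaplacian G) U ≤ Dhat →
      Dhat ≤ 48 * Y → MistakeBound (pdLaplacian G) U γ Dhat (c * γ ^ 2) δ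
        (48 * (2 / c + 2) * Y / γ ^ 2) := by
    intro Dhat Y hD hY
    refine (mistakeBound_of_mem_comparators hM hγ hc hc1 hcδ hU1
      (smul_mem_comparators_of_quasiDim_le hM hne hD)).mono ?_
    have h1 : (2 / c + 2) * Dhat ≤ 48 * (2 / c + 2) * Y := by
      rw [mul_right_comm, mul_comm]
      exact mul_le_mul_of_nonneg_right hY (by positivity)
    exact div_le_div_of_nonneg_right h1 (by positivity)
  refine ⟨fun Dhat hD => ?_, fun Dhat hDhat => ?_⟩
  · have hmem := smul_mem_comparators_of_quasiDim_le hM hne hD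
    have hD0 : 0 ≤ Dhat := by
      refine le_trans (le_csInf hne ?_) hD
      rintro _ ⟨d, P, Q, -, -, -, rfl⟩
      exact sideCost_nonneg hM P Q
    refine ⟨fun A => ?_, hmem, minHingeLoss_mem hM hγ ⟨_, hmem⟩, hbound Dhat Dhat hD (by linarith)⟩
    have hmem' := hmem
    rw [comparators_eq_image hM] at hmem'
    obtain ⟨W, hW, -⟩ := hmem'
    exact existsUnique_isFTRL (isHermitian_sideGamma hM) (isUnit_det_sideGamma hM)
      (sideGamma_inv_mul_inv_apply_le hM) _ A ⟨W, hW.1⟩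
  · have hD : quasiDim γ (pdLaplacian G) (pdLaplacian G) U ≤ Dhat := by
      subst hU
      rw [hDhat]
      exact quasiDim_le hG y Ustar hne
    have hk : (1 : ℝ) ≤ k := by
      have : 0 < k := (Nat.zero_le _).trans_lt (y ⟨0, by omega⟩).isLt
      exact_mod_cast this
    have hcut0 : (0 : ℝ) ≤ cutSize G y := Nat.cast_nonneg _
    have hcc : cutComplexity G y ≤ 2 * (cutSize G y * resDiam G) := by
      rw [cutComplexity_eq, mul_assoc]
      exact mul_le_mul_of_nonneg_left (mul_le_mul_of_nonneg_left hRr hcut0) two_pos.le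
    refine ⟨hD, ?_, fun a ha => ?_, fun a d ha hd => ?_⟩
    · rintro ⟨u, v, huv⟩
      have h1 := one_le_four_mul_cutComplexity hG huv
      exact ⟨hbound Dhat _ hD (by linarith), hbound Dhat _ hD (by linarith)⟩
    · have hc0 : 0 ≤ cutComplexity G y := by rw [cutComplexity_eq]; positivity
      rw [mul_assoc _ (a + 1)]
      exact hbound Dhat _ hD (by linarith)
    · rw [mul_assoc _ (a * (d : ℝ) + 1)]
      have h1 : cutSize G y * resDiam G ≤ a * k * d :=
        mul_le_mul ha (resDiam_le_of_dist_le hG hd) (hR.le.trans hRr) (hcut0.trans ha)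
      have h2 : 0 ≤ a * k * d := mul_nonneg (hcut0.trans ha) (Nat.cast_nonneg _)
      exact hbound Dhat _ hD (by linarith)
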